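/- Let $F$ be a free group (of arbitrary rank) and $R$ a normal subgroup of $F$. Let $\mathfrak f$ be the augmentation ideal of the integral group ring $\mathbb Z[F]$, let $\mathfrak r\subseteq\mathbb Z[R]\subseteq\mathbb Z[F]$ be the augmentation ideal of $\mathbb Z[R]$, and let $\mathfrak r^2$ be the additive subgroup generated by all products of two elements of $\mathfrak r$. Let $\gamma_n(H)$ denote the $n$-th term of the lower central series of a group $H$ (with $\gamma_1(H)=H$), and, for an additive subgroup $\mathfrak a$ of $\mathbb Z[F]$, put $$D(n,\mathfrak a):=F\cap(1+\mathfrak a+\mathfrak f^n)=\{w\in F : w-1\in\mathfrak a+\mathfrak f^n\}.$$ Then (i) $D(3,\mathfrak r^2)=D(3,\mathfrak r^2\mathbb Z[F])=\gamma_2(R)\,\gamma_3(F)$; (ii) $D(4,\mathfrak r^2\mathbb Z[F])\le R\,\gamma_4(F)$. -/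

import Mathlib

noncomputable section

namespace GenDimension

variable {F : Type*} [Group F]

/-- The augmentation map `ℤ[G] → ℤ`, sending every element of `G` to `1`. -/
def augmentation (G : Type*) [Group G] : MonoidAlgebra ℤ G →ₐ[ℤ] ℤ :=
  MonoidAlgebra.lift ℤ ℤ G 1

/-- The augmentation ideal of the integral group ring `ℤ[G]`, as an additive subgroup
(`ℤ`-submodule), so that products and powers are those of additive subgroups of the ring. -/
def augIdeal (G : Type*) [Group G] : Submodule ℤ (MonoidAlgebra ℤ G) :=
  LinearMap.ker (augmentation G).toLinearMap

/-- The augmentation ideal of `ℤ[R]`, for a subgroup `R` of `F`, viewed inside `ℤ[F]` through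
the inclusion `ℤ[R] ⊆ ℤ[F]`. -/
def relAugIdeal (R : Subgroup F) : Submodule ℤ (MonoidAlgebra ℤ F) :=
  (augIdeal R).map (MonoidAlgebra.mapDomainAlgHom ℤ ℤ R.subtype).toLinearMap

/-- `D(n, 𝔞) = F ∩ (1 + 𝔞 + 𝔣ⁿ)`: the elements `w` of `F` with `w - 1 ∈ 𝔞 + 𝔣ⁿ`. -/
def dimSet (n : ℕ) (a : Submodule ℤ (MonoidAlgebra ℤ F)) : Set F :=
  {w | MonoidAlgebra.of ℤ F w - 1 ∈ a ⊔ augIdeal F ^ n}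

/-- `γ n H` is the `n`-th term (`n ≥ 1`) of the lower central series of the subgroup `H`, indexed
so that `γ 1 H = H` and `γ (n + 1) H = ⁅γ n H, H⁆`. -/
def γ (n : ℕ) (H : Subgroup F) : Subgroup F :=
  H.lowerCentralSeries (n - 1)

end GenDimension

end

/-! ### Augmentation ideals, their powers, and the lower central series -/

namespace GenDimension

open MonoidAlgebra
open scoped commutatorElement

/-! Write A for the abelianization of F and B for the image of R in A. Since F is free, the Magnus
expansion gives linear maps `θ₁`, `θ₂`, `θ₃` from ℤ[F] to A, A ⊗ A and A ⊗ A ⊗ A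
(`nonempty_magnusMaps`). The n-th one sends a product of n elements of 𝔣 to the tensor of their
classes, and it kills 𝔣ⁿ⁺¹.

Conversely, the image of w ∈ γₙ(F), n = 2 or 3, in a suitable quotient F/N can be read off from θₙ(w
- 1). If N contains γₙ₊₁(F), the n-fold commutators of F/N are central and multilinear on A, and
they extend to a linear map Φ on the whole tensor power such that w ≡ Φ(θₙ(w - 1)) mod N. The point
is to make Φ also kill the relevant tensors coming from B. Smith normal form supplies a basis of A
adapted to a finitely generated part of B, and Φ is written down on that basis
(`exists_linearMap_wedge_two`, `exists_linearMap_lie_three`).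

Degree two: if w - 1 ∈ 𝔯² + 𝔣³, then `θ₁` puts w in γ₂(F), and θ₂(w - 1) comes from B ⊗ B, so w ∈
γ₂(R)γ₃(F) (`mem_of_θ₂_mem_tensorSq`). Passing from 𝔯² to 𝔯²ℤ[F] only adds 𝔯²𝔣 ⊆ 𝔣³. The reverse
inclusion holds because γ₂(R) - 1 ⊆ 𝔯² and γ₃(F) - 1 ⊆ 𝔣³.

Degree three: after division by a factor in γ₂(R) one has w ∈ γ₃(F) and w - 1 = z + y + v with z ∈
𝔯², y ∈ 𝔯²𝔣, v ∈ 𝔣⁴, which forces θ₂(z) = 0. Modulo the tensor ideal generated by B, the value θ₃(z)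
depends only on an element of B ⊗ B, and B ⊗ B embeds in A ⊗ A by flatness; so θ₃(z) lies in that
ideal (`θ₃_mem_tensorIdeal`), as does θ₃(y). Then `mem_of_θ₃_mem_tensorIdeal` gives w ∈ Rγ₄(F). -/

theorem augIdeal_eq_span (G : Type*) [Group G] :
    augIdeal G = Submodule.span ℤ (Set.range fun g : G => of ℤ G g - 1) := by
  have haug : ∀ g : G, augmentation G (of ℤ G g) = 1 := fun g => by simp [augmentation]
  apply le_antisymm
  · intro z hz
    have key : ∀ z : MonoidAlgebra ℤ G, z - algebraMap ℤ _ (augmentation G z) ∈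
        Submodule.span ℤ (Set.range fun g : G => of ℤ G g - 1) := by
      intro z
      induction z using MonoidAlgebra.induction_on with
      | of g =>
        rw [haug, map_one]
        exact Submodule.subset_span ⟨g, rfl⟩
      | add x y hx hy =>
        rw [map_add, map_add, add_sub_add_comm]
        exact add_mem hx hy
      | smul c x hx =>
        rw [map_smul, smul_eq_mul, map_mul, ← Algebra.smul_def, ← smul_sub]
        exact Submodule.smul_mem _ _ hx
    have h := key z
    have hz' : augmentation G z = 0 := hz
    rwa [hz', map_zero, sub_zero] at h
  · rw [Submodule.span_le]
    rintro _ ⟨g, rfl⟩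
    change augmentation G (of ℤ G g - 1) = 0
    rw [map_sub, haug, map_one, sub_self]

variable {F : Type*} [Group F]

theorem of_sub_one_mem_augIdeal (g : F) : of ℤ F g - 1 ∈ augIdeal F := by
  rw [augIdeal_eq_span]
  exact Submodule.subset_span ⟨g, rfl⟩

theorem relAugIdeal_eq_span (R : Subgroup F) :
    relAugIdeal R = Submodule.span ℤ ((fun g : F => of ℤ F g - 1) '' R) := by
  have e : ∀ g : R, (mapDomainAlgHom ℤ ℤ R.subtype).toLinearMap (of ℤ R g - 1) =
      of ℤ F g - 1 := fun g => by
    rw [map_sub, AlgHom.toLinearMap_apply, AlgHom.toLinearMap_apply, map_one]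
    simp
  rw [relAugIdeal, augIdeal_eq_span, Submodule.map_span]
  congr 1
  ext z
  constructor
  · rintro ⟨_, ⟨g, rfl⟩, rfl⟩
    exact ⟨g, g.2, (e g).symm⟩
  · rintro ⟨g, hg, rfl⟩
    exact ⟨_, ⟨⟨g, hg⟩, rfl⟩, e ⟨g, hg⟩⟩

theorem of_sub_one_mem_relAugIdeal {R : Subgroup F} {g : F} (hg : g ∈ R) :
    of ℤ F g - 1 ∈ relAugIdeal R := by
  rw [relAugIdeal_eq_span]
  exact Submodule.subset_span ⟨g, hg, rfl⟩

theorem relAugIdeal_top : relAugIdeal (⊤ : Subgroup F) = augIdeal F := by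
  rw [relAugIdeal_eq_span, augIdeal_eq_span, Subgroup.coe_top, Set.image_univ]

theorem relAugIdeal_le_augIdeal (R : Subgroup F) : relAugIdeal R ≤ augIdeal F := by
  rw [relAugIdeal_eq_span, ← relAugIdeal_top, relAugIdeal_eq_span]
  exact Submodule.span_mono (Set.image_mono (Set.subset_univ _))

theorem relAugIdeal_mul_self_le (R : Subgroup F) :
    relAugIdeal R * relAugIdeal R ≤ relAugIdeal R := by
  conv_lhs => rw [relAugIdeal_eq_span, Submodule.span_mul_span]
  rw [Submodule.span_le]
  rintro _ ⟨_, ⟨g, hg, rfl⟩, _, ⟨h, hh, rfl⟩, rfl⟩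
  have e : (of ℤ F g - 1) * (of ℤ F h - 1) =
      (of ℤ F (g * h) - 1) - (of ℤ F g - 1) - (of ℤ F h - 1) := by
    rw [map_mul]; noncomm_ring
  change (of ℤ F g - 1) * (of ℤ F h - 1) ∈ relAugIdeal R
  rw [e]
  exact sub_mem (sub_mem (of_sub_one_mem_relAugIdeal (R.mul_mem hg hh))
    (of_sub_one_mem_relAugIdeal hg)) (of_sub_one_mem_relAugIdeal hh)

theorem relAugIdeal_pow_succ_le (R : Subgroup F) {n : ℕ} (hn : 1 ≤ n) :
    relAugIdeal R ^ (n + 1) ≤ relAugIdeal R ^ n := by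
  obtain ⟨m, rfl⟩ := Nat.exists_eq_add_of_le' hn
  rw [pow_succ, pow_succ, mul_assoc]
  exact mul_le_mul_right (relAugIdeal_mul_self_le R) _

theorem augIdeal_pow_antitone {m n : ℕ} (hm : 1 ≤ m) (h : m ≤ n) :
    augIdeal F ^ n ≤ augIdeal F ^ m := by
  induction n, h using Nat.le_induction with
  | base => exact le_rfl
  | succ n hn ih =>
    rw [← relAugIdeal_top] at ih ⊢
    exact (relAugIdeal_pow_succ_le _ (hm.trans hn)).trans ih

theorem top_le_one_sup_augIdeal : (⊤ : Submodule ℤ (MonoidAlgebra ℤ F)) ≤ 1 ⊔ augIdeal F := by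
  intro z _
  have h : z - algebraMap ℤ _ (augmentation F z) ∈ augIdeal F := by
    change augmentation F _ = 0
    rw [map_sub, AlgHom.commutes]
    exact sub_self _
  rw [← add_sub_cancel (algebraMap ℤ (MonoidAlgebra ℤ F) (augmentation F z)) z]
  exact Submodule.add_mem_sup (Submodule.algebraMap_mem _) h

/-- As ℤ[F] = ℤ + 𝔣, the right ideal generated by 𝔞 exceeds 𝔞 only by 𝔞𝔣, which lies one degree
higher. -/
theorem mul_top_le (a : Submodule ℤ (MonoidAlgebra ℤ F)) : a * ⊤ ≤ a ⊔ a * augIdeal F := by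
  calc a * ⊤ ≤ a * (1 ⊔ augIdeal F) := mul_le_mul_right top_le_one_sup_augIdeal a
    _ = a ⊔ a * augIdeal F := by rw [Submodule.mul_sup, mul_one]

theorem le_mul_top (a : Submodule ℤ (MonoidAlgebra ℤ F)) : a ≤ a * ⊤ := fun z hz => by
  simpa using Submodule.mul_mem_mul hz (Submodule.mem_top (x := (1 : MonoidAlgebra ℤ F)))

theorem of_mul_sub_one (g h : F) :
    of ℤ F (g * h) - 1 =
      (of ℤ F g - 1) * (of ℤ F h - 1) + (of ℤ F g - 1) + (of ℤ F h - 1) := by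
  rw [map_mul]; noncomm_ring

theorem of_inv_sub_one (g : F) :
    of ℤ F g⁻¹ - 1 = -((of ℤ F g⁻¹ - 1) * (of ℤ F g - 1)) - (of ℤ F g - 1) := by
  have h : of ℤ F g⁻¹ * of ℤ F g = 1 := by rw [← map_mul, inv_mul_cancel, map_one]
  have : (of ℤ F g⁻¹ - 1) * (of ℤ F g - 1) =
    of ℤ F g⁻¹ * of ℤ F g - of ℤ F g⁻¹ - of ℤ F g + 1 := by noncomm_ring
  rw [this, h]; abel

/-- Here [g, h] - 1 = (gh - hg)(hg)⁻¹. Splitting off 1 from (hg)⁻¹ isolates the ring commutator as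
leading term, with a remainder of higher order. -/
theorem of_commutator_sub_one (g h : F) :
    of ℤ F ⁅g, h⁆ - 1 =
      ((of ℤ F g - 1) * (of ℤ F h - 1) - (of ℤ F h - 1) * (of ℤ F g - 1)) *
        (of ℤ F (g⁻¹ * h⁻¹) - 1) +
      ((of ℤ F g - 1) * (of ℤ F h - 1) - (of ℤ F h - 1) * (of ℤ F g - 1)) := by
  have e1 : (of ℤ F g - 1) * (of ℤ F h - 1) - (of ℤ F h - 1) * (of ℤ F g - 1) =
      of ℤ F (g * h) - of ℤ F (h * g) := by
    rw [map_mul, map_mul]; noncomm_ring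
  have e2 : of ℤ F (h * g) * of ℤ F (g⁻¹ * h⁻¹) = 1 := by
    rw [← map_mul]
    simp [mul_assoc, MonoidAlgebra.one_def]
  rw [e1, mul_sub, mul_one, sub_add_cancel, sub_mul, e2, ← map_mul, commutatorElement_def,
    mul_assoc (g * h)]

/-- If `g ∈ R` satisfies `g - 1 ∈ 𝔯 ^ m`, and `h ∈ R`, then `[g, h] - 1 ∈ 𝔯 ^ (m + 1)`. -/
theorem of_commutator_sub_one_mem {R : Subgroup F} {m : ℕ} {g h : F} (hgR : g ∈ R) (hh : h ∈ R)
    (hg : of ℤ F g - 1 ∈ relAugIdeal R ^ m) :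
    of ℤ F ⁅g, h⁆ - 1 ∈ relAugIdeal R ^ (m + 1) := by
  have h1 : (of ℤ F g - 1) * (of ℤ F h - 1) - (of ℤ F h - 1) * (of ℤ F g - 1) ∈
      relAugIdeal R ^ (m + 1) := by
    refine sub_mem ?_ ?_
    · rw [pow_succ]
      exact Submodule.mul_mem_mul hg (of_sub_one_mem_relAugIdeal hh)
    · rw [pow_succ']
      exact Submodule.mul_mem_mul (of_sub_one_mem_relAugIdeal hh) hg
  rw [of_commutator_sub_one]
  refine add_mem (relAugIdeal_pow_succ_le R (by omega) ?_) h1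
  rw [pow_succ _ (m + 1)]
  exact Submodule.mul_mem_mul h1
    (of_sub_one_mem_relAugIdeal (R.mul_mem (R.inv_mem hgR) (R.inv_mem hh)))

theorem lowerCentralSeries_le_self (R : Subgroup F) (n : ℕ) : R.lowerCentralSeries n ≤ R :=
  R.lowerCentralSeries_antitone (Nat.zero_le n)

theorem of_sub_one_mem_relAugIdeal_pow (R : Subgroup F) (n : ℕ) :
    ∀ g ∈ R.lowerCentralSeries n, of ℤ F g - 1 ∈ relAugIdeal R ^ (n + 1) := by
  induction n with
  | zero =>
    intro g hg
    rw [zero_add, pow_one]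
    exact of_sub_one_mem_relAugIdeal hg
  | succ n ih =>
    have absorb : ∀ x ∈ relAugIdeal R, ∀ y ∈ relAugIdeal R ^ (n + 1 + 1),
        x * y ∈ relAugIdeal R ^ (n + 1 + 1) := fun x hx y hy => by
      refine relAugIdeal_pow_succ_le R (by omega) ?_
      rw [pow_succ']
      exact Submodule.mul_mem_mul hx hy
    intro g hg
    rw [Subgroup.mem_lowerCentralSeries_succ_iff] at hg
    -- Membership in R is carried through the induction because `absorb` needs the extra factor g -
    -- 1 to lie in 𝔯.
    suffices g ∈ R ∧ of ℤ F g - 1 ∈ relAugIdeal R ^ (n + 1 + 1) from this.2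
    induction hg using Subgroup.closure_induction with
    | mem x hx =>
      obtain ⟨p, hp, q, hq, rfl⟩ := hx
      have hpR := lowerCentralSeries_le_self R n hp
      exact ⟨R.mul_mem (R.mul_mem (R.mul_mem hpR hq) (R.inv_mem hpR)) (R.inv_mem hq),
        of_commutator_sub_one_mem hpR hq (ih p hp)⟩
    | one => exact ⟨R.one_mem, by rw [map_one, sub_self]; exact zero_mem _⟩
    | mul x y _ _ hx hy =>
      refine ⟨R.mul_mem hx.1 hy.1, ?_⟩
      rw [of_mul_sub_one]
      exact add_mem (add_mem (absorb _ (of_sub_one_mem_relAugIdeal hx.1) _ hy.2) hx.2) hy.2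
    | inv x _ hx =>
      refine ⟨R.inv_mem hx.1, ?_⟩
      rw [of_inv_sub_one]
      exact sub_mem (neg_mem (absorb _ (of_sub_one_mem_relAugIdeal (R.inv_mem hx.1)) _ hx.2)) hx.2

theorem of_sub_one_mem_augIdeal_pow {n : ℕ} {g : F}
    (hg : g ∈ (⊤ : Subgroup F).lowerCentralSeries n) : of ℤ F g - 1 ∈ augIdeal F ^ (n + 1) := by
  rw [← relAugIdeal_top]
  exact of_sub_one_mem_relAugIdeal_pow ⊤ n g hg

end GenDimension

/-! ### The Magnus expansion and its components in degrees one to three -/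

noncomputable section

namespace GenDimension

open MonoidAlgebra TensorProduct
open scoped commutatorElement

/-- The abelianization of `F`, written additively. -/
abbrev Ab (F : Type*) [Group F] : Type _ := Additive (Abelianization F)

/-- The class of an element of `F` in the abelianization. -/
def toAb {F : Type*} [Group F] (g : F) : Ab F := Additive.ofMul (Abelianization.of g)

theorem toAb_mul {F : Type*} [Group F] (g h : F) : toAb (g * h) = toAb g + toAb h := by
  simp [toAb]

theorem toAb_one {F : Type*} [Group F] : toAb (1 : F) = 0 := by simp [toAb]

theorem toAb_surjective {F : Type*} [Group F] : Function.Surjective (toAb : F → Ab F) := by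
  intro a
  obtain ⟨g, hg⟩ := QuotientGroup.mk_surjective (s := commutator F) a.toMul
  exact ⟨g, hg⟩

theorem toAb_eq_zero_iff {F : Type*} [Group F] {g : F} :
    toAb g = 0 ↔ g ∈ (⊤ : Subgroup F).lowerCentralSeries 1 := by
  rw [Subgroup.top_lowerCentralSeries_one]
  exact QuotientGroup.eq_one_iff (N := commutator F) g

section PowerSeriesUnit

variable {S : Type*} [Ring S]

/-- The unit `1 + aX` of the ring of formal power series. -/
def oneAddMulX (a : S) : (PowerSeries S)ˣ where
  val := 1 + PowerSeries.C a * PowerSeries.X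
  inv := PowerSeries.mk fun n => (-a) ^ n
  val_inv := by
    ext n
    rw [add_mul, one_mul, mul_assoc, map_add, PowerSeries.coeff_C_mul, PowerSeries.coeff_mk]
    cases n with
    | zero => simp
    | succ n => simp [PowerSeries.coeff_succ_X_mul, pow_succ', PowerSeries.coeff_one]
  inv_val := by
    ext n
    rw [mul_add, mul_one, ← mul_assoc, map_add, PowerSeries.coeff_mk]
    cases n with
    | zero => simp
    | succ n =>
      simp [PowerSeries.coeff_succ_mul_X, PowerSeries.coeff_mul_C, pow_succ,
        PowerSeries.coeff_one]

end PowerSeriesUnit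

variable {F X : Type*} [Group F]

theorem Ab.hom_ext (b : FreeGroupBasis X F) {M : Type*} [AddCommGroup M] {f g : Ab F →ₗ[ℤ] M}
    (h : ∀ x, f (toAb (b x)) = g (toAb (b x))) : f = g := by
  have e : (AddMonoidHom.toMultiplicative f.toAddMonoidHom).comp
      (Abelianization.of (G := F) : F →* Multiplicative (Ab F)) =
      (AddMonoidHom.toMultiplicative g.toAddMonoidHom).comp
      (Abelianization.of (G := F) : F →* Multiplicative (Ab F)) :=
    b.ext_hom _ _ h
  ext a
  obtain ⟨g, rfl⟩ := toAb_surjective a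
  exact DFunLike.congr_fun e g

/-- The Magnus homomorphism on group elements, sending a generator `x` to `1 + xX`. -/
def magnusUnit (b : FreeGroupBasis X F) : F →* (PowerSeries (MonoidAlgebra ℤ (FreeMonoid X)))ˣ :=
  b.lift fun x => oneAddMulX (of ℤ _ (FreeMonoid.of x))

theorem magnusUnit_basis (b : FreeGroupBasis X F) (x : X) :
    magnusUnit b (b x) = oneAddMulX (of ℤ _ (FreeMonoid.of x)) :=
  congr_fun (b.lift.symm_apply_apply _) x

/-- The Magnus homomorphism, with values in formal power series over the ring `ℤ⟨X⟩`. -/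
def magnus (b : FreeGroupBasis X F) :
    MonoidAlgebra ℤ F →ₐ[ℤ] PowerSeries (MonoidAlgebra ℤ (FreeMonoid X)) :=
  MonoidAlgebra.lift ℤ _ F ((Units.coeHom _).comp (magnusUnit b))

theorem magnus_of (b : FreeGroupBasis X F) (g : F) : magnus b (of ℤ F g) = magnusUnit b g := by
  rw [magnus, MonoidAlgebra.lift_of]
  rfl

/-- The homogeneous component of degree `n` of the Magnus homomorphism. -/
def magnusCoeff (b : FreeGroupBasis X F) (n : ℕ) :
    MonoidAlgebra ℤ F →ₗ[ℤ] MonoidAlgebra ℤ (FreeMonoid X) where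
  toFun z := PowerSeries.coeff n (magnus b z)
  map_add' x y := by rw [map_add, map_add]
  map_smul' c x := by rw [map_zsmul, map_zsmul]; rfl

theorem magnusCoeff_mul (b : FreeGroupBasis X F) (n : ℕ) (u v : MonoidAlgebra ℤ F) :
    magnusCoeff b n (u * v) =
      ∑ p ∈ Finset.HasAntidiagonal.antidiagonal n, magnusCoeff b p.1 u * magnusCoeff b p.2 v := by
  change PowerSeries.coeff n (magnus b (u * v)) = _
  rw [map_mul, PowerSeries.coeff_mul]
  rfl

/-- The linearization of the generators. -/
def abToWords (b : FreeGroupBasis X F) : Ab F →ₗ[ℤ] MonoidAlgebra ℤ (FreeMonoid X) :=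
  (MonoidHom.toAdditiveLeft (Abelianization.lift
    (b.lift fun x => Multiplicative.ofAdd (of ℤ _ (FreeMonoid.of x))))).toIntLinearMap

theorem abToWords_toAb (b : FreeGroupBasis X F) (x : X) :
    abToWords b (toAb (b x)) = of ℤ _ (FreeMonoid.of x) := by
  change (b.lift (fun x => Multiplicative.ofAdd (of ℤ _ (FreeMonoid.of x))) (b x)).toAdd = _
  rw [show b.lift (fun x => Multiplicative.ofAdd (of ℤ _ (FreeMonoid.of x))) (b x) = _ from
    congr_fun (b.lift.symm_apply_apply _) x]
  rfl

theorem magnus_basis (b : FreeGroupBasis X F) (x : X) :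
    magnus b (of ℤ F (b x)) =
      1 + PowerSeries.C (of ℤ _ (FreeMonoid.of x)) * PowerSeries.X := by
  rw [magnus_of, magnusUnit_basis]
  rfl

theorem magnusCoeff_zero_of (b : FreeGroupBasis X F) (g : F) :
    magnusCoeff b 0 (of ℤ F g) = 1 := by
  have e : (Units.map (PowerSeries.constantCoeff
      (R := MonoidAlgebra ℤ (FreeMonoid X))).toMonoidHom).comp
      (magnusUnit b) = 1 := by
    refine b.ext_hom _ _ fun x => Units.ext ?_
    change PowerSeries.constantCoeff (magnusUnit b (b x)).val = 1
    rw [← magnus_of, magnus_basis]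
    simp
  have h := congr_arg Units.val (DFunLike.congr_fun e g)
  change PowerSeries.constantCoeff (magnusUnit b g).val = 1 at h
  rw [← magnus_of] at h
  change PowerSeries.coeff 0 (magnus b (of ℤ F g)) = 1
  rw [PowerSeries.coeff_zero_eq_constantCoeff_apply, h]

theorem magnusCoeff_one_of (b : FreeGroupBasis X F) (g : F) :
    magnusCoeff b 1 (of ℤ F g) = abToWords b (toAb g) := by
  let c : F →* Multiplicative (MonoidAlgebra ℤ (FreeMonoid X)) :=
    MonoidHom.mk' (fun g => Multiplicative.ofAdd (magnusCoeff b 1 (of ℤ F g))) fun g h => by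
      rw [map_mul, magnusCoeff_mul, ← ofAdd_add]
      rw [Finset.Nat.sum_antidiagonal_succ, Finset.Nat.antidiagonal_zero, Finset.sum_singleton,
        magnusCoeff_zero_of, magnusCoeff_zero_of, one_mul, mul_one, add_comm]
  let d : F →* Multiplicative (MonoidAlgebra ℤ (FreeMonoid X)) :=
    MonoidHom.mk' (fun g => Multiplicative.ofAdd (abToWords b (toAb g))) fun g h => by
      rw [toAb_mul, map_add, ofAdd_add]
  have e : c = d := b.ext_hom _ _ fun x => by
    change magnusCoeff b 1 (of ℤ F (b x)) = abToWords b (toAb (b x))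
    rw [abToWords_toAb]
    change PowerSeries.coeff 1 (magnus b (of ℤ F (b x))) = _
    rw [magnus_basis]
    simp [PowerSeries.coeff_one]
  exact DFunLike.congr_fun e g

theorem magnusCoeff_one_right (b : FreeGroupBasis X F) (n : ℕ) :
    magnusCoeff b n 1 = if n = 0 then 1 else 0 := by
  change PowerSeries.coeff n (magnus b 1) = _
  rw [map_one, PowerSeries.coeff_one]

theorem magnusCoeff_zero_of_mem (b : FreeGroupBasis X F) {u : MonoidAlgebra ℤ F}
    (hu : u ∈ augIdeal F) : magnusCoeff b 0 u = 0 := by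
  suffices augIdeal F ≤ LinearMap.ker (magnusCoeff b 0) from this hu
  rw [augIdeal_eq_span, Submodule.span_le]
  rintro _ ⟨g, rfl⟩
  change magnusCoeff b 0 _ = 0
  rw [map_sub, magnusCoeff_zero_of, magnusCoeff_one_right, if_pos rfl, sub_self]

theorem magnusCoeff_one_of_mem (b : FreeGroupBasis X F) {u : MonoidAlgebra ℤ F}
    (hu : u ∈ augIdeal F) : magnusCoeff b 1 u ∈ LinearMap.range (abToWords b) := by
  suffices augIdeal F ≤ (LinearMap.range (abToWords b)).comap (magnusCoeff b 1) from this hu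
  rw [augIdeal_eq_span, Submodule.span_le]
  rintro _ ⟨g, rfl⟩
  refine ⟨toAb g, ?_⟩
  rw [map_sub, magnusCoeff_one_of, magnusCoeff_one_right, if_neg one_ne_zero, sub_zero]

/-- The linear map on `ℤ⟨X⟩` with given values on words. -/
def wordLift {M : Type*} [AddCommGroup M] (f : List X → M) :
    MonoidAlgebra ℤ (FreeMonoid X) →ₗ[ℤ] M :=
  Finsupp.linearCombination ℤ (fun w => f (FreeMonoid.toList w)) ∘ₗ
    (coeffLinearEquiv ℤ).toLinearMap

theorem wordLift_of {M : Type*} [AddCommGroup M] (f : List X → M) (w : FreeMonoid X) :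
    wordLift f (of ℤ _ w) = f (FreeMonoid.toList w) := by
  simp [wordLift]

/-- Projection of `ℤ⟨X⟩` onto its component of degree one. -/
def wordProj₁ (b : FreeGroupBasis X F) : MonoidAlgebra ℤ (FreeMonoid X) →ₗ[ℤ] Ab F :=
  wordLift fun w => match w with
    | [x] => toAb (b x)
    | _ => 0

/-- Projection of `ℤ⟨X⟩` onto its component of degree two. -/
def wordProj₂ (b : FreeGroupBasis X F) :
    MonoidAlgebra ℤ (FreeMonoid X) →ₗ[ℤ] Ab F ⊗[ℤ] Ab F :=
  wordLift fun w => match w with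
    | [x, y] => toAb (b x) ⊗ₜ toAb (b y)
    | _ => 0

/-- Projection of `ℤ⟨X⟩` onto its component of degree three. -/
def wordProj₃ (b : FreeGroupBasis X F) :
    MonoidAlgebra ℤ (FreeMonoid X) →ₗ[ℤ] Ab F ⊗[ℤ] (Ab F ⊗[ℤ] Ab F) :=
  wordLift fun w => match w with
    | [x, y, z] => toAb (b x) ⊗ₜ (toAb (b y) ⊗ₜ toAb (b z))
    | _ => 0

theorem wordProj₁_abToWords (b : FreeGroupBasis X F) (a : Ab F) :
    wordProj₁ b (abToWords b a) = a := by
  suffices wordProj₁ b ∘ₗ abToWords b = LinearMap.id from LinearMap.congr_fun this a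
  refine Ab.hom_ext b fun x => ?_
  rw [LinearMap.comp_apply, abToWords_toAb, wordProj₁, wordLift_of]
  rfl

theorem wordProj₂_mul (b : FreeGroupBasis X F) (a₁ a₂ : Ab F) :
    wordProj₂ b (abToWords b a₁ * abToWords b a₂) = a₁ ⊗ₜ a₂ := by
  suffices ((LinearMap.mul ℤ _).compl₁₂ (abToWords b) (abToWords b)).compr₂ (wordProj₂ b) =
      TensorProduct.mk ℤ (Ab F) (Ab F) from LinearMap.congr_fun₂ this a₁ a₂
  refine Ab.hom_ext b fun x => Ab.hom_ext b fun y => ?_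
  change wordProj₂ b (abToWords b _ * abToWords b _) = _
  rw [abToWords_toAb, abToWords_toAb, ← map_mul, wordProj₂, wordLift_of]
  rfl

theorem wordProj₃_mul (b : FreeGroupBasis X F) (a₁ a₂ a₃ : Ab F) :
    wordProj₃ b (abToWords b a₁ * abToWords b a₂ * abToWords b a₃) = a₁ ⊗ₜ (a₂ ⊗ₜ a₃) := by
  -- The identity is trilinear, so each argument can be reduced to generators in turn: the third
  -- here, the second in `h₂`, the first in `h₁`.
  have h₃ : ∀ x y, wordProj₃ b ∘ₗ LinearMap.mulLeft ℤ
      (abToWords b (toAb (b x)) * abToWords b (toAb (b y))) ∘ₗ abToWords b =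
      TensorProduct.mk ℤ (Ab F) (Ab F ⊗[ℤ] Ab F) (toAb (b x)) ∘ₗ
        TensorProduct.mk ℤ (Ab F) (Ab F) (toAb (b y)) := by
    refine fun x y => Ab.hom_ext b fun z => ?_
    change wordProj₃ b (abToWords b _ * abToWords b _ * abToWords b _) = _
    rw [abToWords_toAb, abToWords_toAb, abToWords_toAb, ← map_mul, ← map_mul, wordProj₃,
      wordLift_of]
    rfl
  have h₂ : ∀ x, wordProj₃ b ∘ₗ LinearMap.mulRight ℤ (abToWords b a₃) ∘ₗ
      LinearMap.mulLeft ℤ (abToWords b (toAb (b x))) ∘ₗ abToWords b =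
      TensorProduct.mk ℤ (Ab F) (Ab F ⊗[ℤ] Ab F) (toAb (b x)) ∘ₗ
        (TensorProduct.mk ℤ (Ab F) (Ab F)).flip a₃ :=
    fun x => Ab.hom_ext b fun y => LinearMap.congr_fun (h₃ x y) a₃
  have h₁ : wordProj₃ b ∘ₗ LinearMap.mulRight ℤ (abToWords b a₃) ∘ₗ
      LinearMap.mulRight ℤ (abToWords b a₂) ∘ₗ abToWords b =
      (TensorProduct.mk ℤ (Ab F) (Ab F ⊗[ℤ] Ab F)).flip (a₂ ⊗ₜ a₃) :=
    Ab.hom_ext b fun x => LinearMap.congr_fun (h₂ x) a₂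
  exact LinearMap.congr_fun h₁ a₁

/-- Linear maps on `ℤ[F]` that detect the successive quotients `𝔣 ^ n / 𝔣 ^ (n + 1)`, `n ≤ 3`,
of the augmentation powers as tensor powers of the abelianization. -/
structure MagnusMaps (F : Type*) [Group F] where
  /-- The component of degree one. -/
  θ₁ : MonoidAlgebra ℤ F →ₗ[ℤ] Ab F
  /-- The component of degree two. -/
  θ₂ : MonoidAlgebra ℤ F →ₗ[ℤ] Ab F ⊗[ℤ] Ab F
  /-- The component of degree three. -/
  θ₃ : MonoidAlgebra ℤ F →ₗ[ℤ] Ab F ⊗[ℤ] (Ab F ⊗[ℤ] Ab F)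
  θ₁_of_sub_one (g : F) : θ₁ (of ℤ F g - 1) = toAb g
  θ₁_mul {u v} : u ∈ augIdeal F → v ∈ augIdeal F → θ₁ (u * v) = 0
  θ₂_mul {u v} : u ∈ augIdeal F → v ∈ augIdeal F → θ₂ (u * v) = θ₁ u ⊗ₜ θ₁ v
  θ₃_mul {u v w} : u ∈ augIdeal F → v ∈ augIdeal F → w ∈ augIdeal F →
    θ₃ (u * v * w) = θ₁ u ⊗ₜ (θ₁ v ⊗ₜ θ₁ w)

/-- Elements of 𝔣 have zero constant term, so the degree n part of a product of n of them is the
product of their degree one parts. These are combinations of letters, and the projection to words of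
length n turns their product into a tensor. -/
theorem nonempty_magnusMaps (F : Type*) [Group F] [IsFreeGroup F] : Nonempty (MagnusMaps F) := by
  let b := IsFreeGroup.basis F
  have h₁ : ∀ {u}, u ∈ augIdeal F →
      abToWords b (wordProj₁ b (magnusCoeff b 1 u)) = magnusCoeff b 1 u := fun {u} hu => by
    obtain ⟨a, ha⟩ := magnusCoeff_one_of_mem b hu
    rw [← ha, wordProj₁_abToWords]
  refine ⟨{
    θ₁ := wordProj₁ b ∘ₗ magnusCoeff b 1
    θ₂ := wordProj₂ b ∘ₗ magnusCoeff b 2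
    θ₃ := wordProj₃ b ∘ₗ magnusCoeff b 3
    θ₁_of_sub_one := fun g => ?_
    θ₁_mul := fun {u v} hu hv => ?_
    θ₂_mul := fun {u v} hu hv => ?_
    θ₃_mul := fun {u v w} hu hv hw => ?_ }⟩
  · rw [LinearMap.comp_apply, map_sub, magnusCoeff_one_of, magnusCoeff_one_right,
      if_neg one_ne_zero, sub_zero, wordProj₁_abToWords]
  · simp [magnusCoeff_mul, Finset.Nat.antidiagonal_succ, magnusCoeff_zero_of_mem b hu,
      magnusCoeff_zero_of_mem b hv]
  · rw [LinearMap.comp_apply, LinearMap.comp_apply, LinearMap.comp_apply, ← wordProj₂_mul b,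
      h₁ hu, h₁ hv]
    simp [magnusCoeff_mul, Finset.Nat.antidiagonal_succ, magnusCoeff_zero_of_mem b hu,
      magnusCoeff_zero_of_mem b hv]
  · rw [LinearMap.comp_apply, LinearMap.comp_apply, LinearMap.comp_apply, LinearMap.comp_apply,
      ← wordProj₃_mul b, h₁ hu, h₁ hv, h₁ hw]
    simp [magnusCoeff_mul, Finset.Nat.antidiagonal_succ, magnusCoeff_zero_of_mem b hu,
      magnusCoeff_zero_of_mem b hv, magnusCoeff_zero_of_mem b hw]

end GenDimension

end

/-! ### Adapted bases, and extension of commutator forms to tensor powers -/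

noncomputable section

namespace GenDimension

open TensorProduct

instance Ab.module_free (F : Type*) [Group F] [IsFreeGroup F] : Module.Free ℤ (Ab F) :=
  Module.Free.of_equiv
    ((MulEquiv.toAdditive (IsFreeGroup.basis F).repr.abelianizationCongr).trans
      (FreeAbelianGroup.equivFinsupp (IsFreeGroup.Generators F))).symm.toIntLinearEquiv

universe u

section Smith

variable {A : Type*} [AddCommGroup A]

/-- A finitely generated subgroup of a free abelian group is generated by multiples of the
elements of a suitable basis. -/
theorem exists_basis_le_span_multiples {ι : Type u} (b : Module.Basis ι ℤ A) (N : Submodule ℤ A)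
    (hN : N.FG) : ∃ (κ : Type u) (e : Module.Basis κ ℤ A),
      N ≤ Submodule.span ℤ {x | x ∈ N ∧ ∃ i, ∃ c : ℤ, x = c • e i} := by
  classical
  obtain ⟨S, hS⟩ := hN
  -- Smith normal form needs finite rank. The generators of N involve only the finitely many basis
  -- vectors in Y, so it is applied inside their span, and the remaining basis vectors are kept
  -- unchanged.
  let Y : Set ι := ↑(S.biUnion fun s => (b.repr s).support)
  have hY : N ≤ (Finsupp.supported ℤ ℤ Y).comap b.repr.toLinearMap := by
    rw [← hS, Submodule.span_le]
    intro s hs i hi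
    exact Finset.mem_coe.2 (Finset.mem_biUnion.2 ⟨s, hs, hi⟩)
  let E : A ≃ₗ[ℤ] (Y →₀ ℤ) × ((Yᶜ : Set ι) →₀ ℤ) :=
    b.repr.trans ((Finsupp.domLCongr (Equiv.Set.sumCompl Y).symm).trans
      (Finsupp.sumFinsuppLEquivProdFinsupp ℤ))
  have hE : ∀ x ∈ N, (E x).2 = 0 := fun x hx => by
    ext ⟨i, hi⟩
    have h : b.repr x i = 0 := by
      by_contra h
      exact hi (hY hx (Finsupp.mem_support_iff.2 h))
    simpa [E] using h
  let N' : Submodule ℤ (Y →₀ ℤ) := N.map (LinearMap.fst ℤ _ _ ∘ₗ E.toLinearMap)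
  have hE' : ∀ x ∈ N, E.symm ((E x).1, 0) = x := fun x hx => by
    rw [← hE x hx]
    exact E.symm_apply_apply x
  have hN' : ∀ p ∈ N', E.symm (p, 0) ∈ N := by
    rintro _ ⟨x, hx, rfl⟩
    rw [show E.symm ((LinearMap.fst ℤ _ _ ∘ₗ E.toLinearMap) x, 0) = x from hE' x hx]
    exact hx
  obtain ⟨n, bM, bN, f, a, snf⟩ := N'.smithNormalForm Finsupp.basisSingleOne
  let e := (bM.prod (Finsupp.basisSingleOne (R := ℤ) (ι := (Yᶜ : Set ι)))).map E.symm
  refine ⟨_, e, fun x hx => ?_⟩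
  have hspan : N' ≤ (Submodule.span ℤ {x | x ∈ N ∧ ∃ i, ∃ c : ℤ, x = c • e i}).comap
      (E.symm.toLinearMap ∘ₗ LinearMap.inl ℤ _ _) := by
    intro p hp
    have hr := bN.sum_repr ⟨p, hp⟩
    have hr' := congr_arg Subtype.val hr
    rw [Submodule.coe_sum] at hr'
    rw [← show _ = p from hr']
    refine Submodule.sum_mem _ fun i _ => ?_
    rw [Submodule.coe_smul]
    refine Submodule.smul_mem _ _ (Submodule.subset_span ⟨hN' _ (bN i).2, Sum.inl (f i), a i, ?_⟩)
    rw [snf, map_smul]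
    congr 1
    simp [e]
  exact Set.mem_of_eq_of_mem (hE' x hx).symm
    (hspan (show (E x).1 ∈ N' from Submodule.mem_map_of_mem hx))

theorem eq_zero_of_basis {ι P : Type*} [AddCommGroup P] (e : Module.Basis ι ℤ A) (f : A → P)
    (hf : ∀ a b, f (a + b) = f a + f b) (h : ∀ i, f (e i) = 0) (a : A) : f a = 0 := by
  have : (AddMonoidHom.mk' f hf).toIntLinearMap = 0 := e.ext h
  exact LinearMap.congr_fun this a

variable {P : Type*} [AddCommGroup P]

/-- Φ is the strictly upper triangular half of κ in a basis adapted to N, so antisymmetrizing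
returns κ. N is spanned by multiples of basis vectors that lie in N, and on two of these Φ is either
0 or a value of κ on N; in an arbitrary basis this would fail. -/
theorem exists_linearMap_wedge_two [Module.Free ℤ A] (N : Submodule ℤ A) (hN : N.FG)
    (κ : A →ₗ[ℤ] A →ₗ[ℤ] P) (hκ : ∀ a, κ a a = 0) (hκN : ∀ x ∈ N, ∀ y ∈ N, κ x y = 0) :
    ∃ Φ : A ⊗[ℤ] A →ₗ[ℤ] P, (∀ a b, Φ (a ⊗ₜ b - b ⊗ₜ a) = κ a b) ∧
      ∀ x ∈ N, ∀ y ∈ N, Φ (x ⊗ₜ y) = 0 := by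
  classical
  obtain ⟨ι, e, he⟩ := exists_basis_le_span_multiples (Module.Free.chooseBasis ℤ A) N hN
  let _ : LinearOrder ι := IsWellOrder.linearOrder WellOrderingRel
  have hanti : ∀ a b, κ b a = -κ a b := fun a b => by
    have := hκ (a + b)
    simp only [map_add, LinearMap.add_apply, hκ, zero_add, add_zero] at this
    exact eq_neg_of_add_eq_zero_left this
  let φ : ι → ι → P := fun p q => if p < q then κ (e p) (e q) else 0
  let Φ : A ⊗[ℤ] A →ₗ[ℤ] P := lift (e.constr ℤ fun p => e.constr ℤ fun q => φ p q)
  have hΦ : ∀ p q, Φ (e p ⊗ₜ e q) = φ p q := fun p q => by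
    change lift _ _ = _
    rw [lift.tmul, e.constr_basis, e.constr_basis]
  refine ⟨Φ, fun a b => ?_, ?_⟩
  · refine sub_eq_zero.1 (eq_zero_of_basis e (fun a => Φ (a ⊗ₜ b - b ⊗ₜ a) - κ a b) ?_
      (fun p => eq_zero_of_basis e (fun b => Φ (e p ⊗ₜ b - b ⊗ₜ e p) - κ (e p) b) ?_
        (fun q => ?_) b) a)
    · intro a a'
      simp only [add_tmul, tmul_add, map_add, map_sub, LinearMap.add_apply]
      abel
    · intro a a'
      simp only [add_tmul, tmul_add, map_add, map_sub]
      abel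
    · rw [map_sub, hΦ, hΦ]
      rcases lt_trichotomy p q with h | rfl | h
      · simp [φ, h, h.not_gt]
      · simp [hκ]
      · simp [φ, h, h.not_gt, hanti (e p) (e q)]
  · intro x hx y hy
    have h : ∀ x, (x ∈ N ∧ ∃ i, ∃ c : ℤ, x = c • e i) → ∀ y ∈ N, Φ (x ⊗ₜ y) = 0 := by
      rintro _ ⟨hx, p, c, rfl⟩
      suffices N ≤ LinearMap.ker (Φ ∘ₗ mk ℤ A A (c • e p)) from fun y hy => this hy
      refine he.trans (Submodule.span_le.2 ?_)
      rintro _ ⟨hy, q, d, rfl⟩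
      change Φ ((c • e p) ⊗ₜ (d • e q)) = 0
      rw [smul_tmul_smul, map_smul, hΦ]
      by_cases hpq : p < q
      · have := hκN _ hx _ hy
        rw [map_smul, map_smul, LinearMap.smul_apply, smul_smul] at this
        simpa [φ, hpq, mul_comm] using this
      · simp [φ, hpq]
    suffices N ≤ LinearMap.ker (Φ ∘ₗ (mk ℤ A A).flip y) from this hx
    exact he.trans (Submodule.span_le.2 fun x hx => h x hx y hy)

/-- The four-term tensor is the expansion of [[a, b], c] into words. In an ordered basis a Lie
element of degree three is determined by its coefficients at certain words beginning with their
least letter, and Φ reads off only these. Each of its values on basis tensors is 0 or κ at a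
permutation of the same letters, so it inherits the vanishing of κ on N. -/
theorem exists_linearMap_lie_three [Module.Free ℤ A] (N : Submodule ℤ A) (hN : N.FG)
    (κ : A →ₗ[ℤ] A →ₗ[ℤ] A →ₗ[ℤ] P) (hκ : ∀ a c, κ a a c = 0)
    (jacobi : ∀ a b c, κ a b c + κ b c a + κ c a b = 0)
    (hκN : ∀ x ∈ N, ∀ y z, κ x y z = 0 ∧ κ y z x = 0) :
    ∃ Φ : A ⊗[ℤ] (A ⊗[ℤ] A) →ₗ[ℤ] P,
      (∀ a b c, Φ (a ⊗ₜ (b ⊗ₜ c) - b ⊗ₜ (a ⊗ₜ c) - c ⊗ₜ (a ⊗ₜ b) + c ⊗ₜ (b ⊗ₜ a)) = κ a b c) ∧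
      ∀ x ∈ N, ∀ y z, Φ (x ⊗ₜ (y ⊗ₜ z)) = 0 ∧ Φ (y ⊗ₜ (x ⊗ₜ z)) = 0 ∧
        Φ (y ⊗ₜ (z ⊗ₜ x)) = 0 := by
  classical
  obtain ⟨ι, e, he⟩ := exists_basis_le_span_multiples (Module.Free.chooseBasis ℤ A) N hN
  let _ : LinearOrder ι := IsWellOrder.linearOrder WellOrderingRel
  have hanti : ∀ a b c, κ b a c = -κ a b c := fun a b c => by
    have := hκ (a + b) c
    simp only [map_add, LinearMap.add_apply, hκ, zero_add, add_zero] at this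
    exact eq_neg_of_add_eq_zero_left this
  -- For a repeated least letter p, the word ppr has coefficient 1 in [[r, p], p], whence the value
  -- κ (e r) (e p) (e p).
  let φ : ι → ι → ι → P := fun p q r =>
    if p < r then if p < q then κ (e p) (e q) (e r) else if p = q then κ (e r) (e p) (e p) else 0
    else 0
  let Φ : A ⊗[ℤ] (A ⊗[ℤ] A) →ₗ[ℤ] P :=
    lift (e.constr ℤ fun p => lift (e.constr ℤ fun q => e.constr ℤ fun r => φ p q r))
  have hΦ : ∀ p q r, Φ (e p ⊗ₜ (e q ⊗ₜ e r)) = φ p q r := fun p q r => by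
    change lift _ _ = _
    rw [lift.tmul]
    refine (LinearMap.congr_fun (e.constr_basis ℤ _ p) _).trans ((lift.tmul _ _).trans ?_)
    rw [e.constr_basis, e.constr_basis]
  have hφ : ∀ p q r, φ p q r - φ q p r - φ r p q + φ r q p = κ (e p) (e q) (e r) := by
    intro p q r
    have j := jacobi (e p) (e q) (e r)
    have h₁ := hanti (e p) (e q) (e r)
    have h₂ := hanti (e r) (e q) (e p)
    have h₃ := hanti (e r) (e p) (e q)
    rcases lt_trichotomy p q with h | rfl | h
    · rcases lt_trichotomy p r with h' | rfl | h'
      · simp [φ, h, h', h.not_gt, h'.not_gt, h'.ne', h.ne']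
      · simp [φ, h, h.not_gt, h₁]
      -- When the third index is strictly the least, both surviving words begin with it, and Jacobi
      -- is needed to recover κ; the same happens for q < p below, and in no other case.
      · have := h'.trans h
        simp only [φ, h, h', h.not_gt, h'.not_gt, this, this.not_gt, if_true, if_false]
        rw [← sub_eq_zero, ← neg_eq_zero, ← j, h₂]
        abel
    · simp [hκ]
    · rcases lt_trichotomy q r with h' | rfl | h'
      · simp [φ, h, h', h.not_gt, h'.not_gt, h.ne', h'.ne', h₁]
      · simp [φ, h, h.not_gt]
      · have := h'.trans h
        simp only [φ, h, h', h.not_gt, h'.not_gt, this, this.not_gt, if_true, if_false]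
        rw [← sub_eq_zero, ← neg_eq_zero, ← j, h₂]
        abel
  refine ⟨Φ, fun a b c => ?_, ?_⟩
  · refine sub_eq_zero.1 (eq_zero_of_basis e (fun a => Φ (a ⊗ₜ (b ⊗ₜ c) - b ⊗ₜ (a ⊗ₜ c) -
      c ⊗ₜ (a ⊗ₜ b) + c ⊗ₜ (b ⊗ₜ a)) - κ a b c) ?_
      (fun p => eq_zero_of_basis e (fun b => Φ (e p ⊗ₜ (b ⊗ₜ c) - b ⊗ₜ (e p ⊗ₜ c) -
      c ⊗ₜ (e p ⊗ₜ b) + c ⊗ₜ (b ⊗ₜ e p)) - κ (e p) b c) ?_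
      (fun q => eq_zero_of_basis e (fun c => Φ (e p ⊗ₜ (e q ⊗ₜ c) - e q ⊗ₜ (e p ⊗ₜ c) -
      c ⊗ₜ (e p ⊗ₜ e q) + c ⊗ₜ (e q ⊗ₜ e p)) - κ (e p) (e q) c) ?_ (fun r => ?_) c) b) a)
    · intro a a'
      simp only [add_tmul, tmul_add, map_add, map_sub, LinearMap.add_apply]
      abel
    · intro a a'
      simp only [add_tmul, tmul_add, map_add, map_sub, LinearMap.add_apply]
      abel
    · intro a a'
      simp only [add_tmul, tmul_add, map_add, map_sub]
      abel
    · rw [map_add, map_sub, map_sub, hΦ, hΦ, hΦ, hΦ, hφ, sub_self]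
  · intro x hx y z
    have hκN' : ∀ x ∈ N, ∀ y z, κ y x z = 0 := fun x hx y z => by
      rw [hanti, (hκN x hx y z).1, neg_zero]
    have key : ∀ p, ∀ c : ℤ, c • e p ∈ N → ∀ q r, c • φ p q r = 0 ∧ c • φ q p r = 0 ∧
        c • φ q r p = 0 := by
      intro p c hx q r
      have k₁ : ∀ y z, c • κ (e p) y z = 0 := fun y z => by
        rw [← (hκN _ hx y z).1, map_smul, LinearMap.smul_apply, LinearMap.smul_apply]
      have k₂ : ∀ y z, c • κ y (e p) z = 0 := fun y z => by
        rw [← hκN' _ hx y z, map_smul, LinearMap.smul_apply]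
      have k₃ : ∀ y z, c • κ y z (e p) = 0 := fun y z => by
        rw [← (hκN _ hx y z).2, map_smul]
      simp only [φ]
      refine ⟨?_, ?_, ?_⟩ <;> split_ifs <;> (try subst_vars) <;>
        first | exact smul_zero c | exact k₁ _ _ | exact k₂ _ _ | exact k₃ _ _
    have h₁ : N ≤ LinearMap.ker (Φ ∘ₗ (mk ℤ A (A ⊗[ℤ] A)).flip (y ⊗ₜ z)) := by
      refine he.trans (Submodule.span_le.2 ?_)
      rintro _ ⟨hx, p, c, rfl⟩
      change Φ ((c • e p) ⊗ₜ (y ⊗ₜ z)) = 0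
      refine eq_zero_of_basis e (fun y => Φ ((c • e p) ⊗ₜ (y ⊗ₜ z))) ?_ (fun q =>
        eq_zero_of_basis e (fun z => Φ ((c • e p) ⊗ₜ (e q ⊗ₜ z))) ?_ (fun r => ?_) z) y
      · intro a b; simp only [add_tmul, tmul_add, map_add]
      · intro a b; simp only [tmul_add, map_add]
      · rw [← smul_tmul', map_smul, hΦ]
        exact (key p c hx q r).1
    have h₂ : N ≤ LinearMap.ker (Φ ∘ₗ mk ℤ A (A ⊗[ℤ] A) y ∘ₗ (mk ℤ A A).flip z) := by
      refine he.trans (Submodule.span_le.2 ?_)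
      rintro _ ⟨hx, p, c, rfl⟩
      change Φ (y ⊗ₜ ((c • e p) ⊗ₜ z)) = 0
      refine eq_zero_of_basis e (fun y => Φ (y ⊗ₜ ((c • e p) ⊗ₜ z))) ?_ (fun q =>
        eq_zero_of_basis e (fun z => Φ (e q ⊗ₜ ((c • e p) ⊗ₜ z))) ?_ (fun r => ?_) z) y
      · intro a b; simp only [add_tmul, map_add]
      · intro a b; simp only [tmul_add, map_add]
      · change (Φ ∘ₗ mk ℤ A (A ⊗[ℤ] A) (e q) ∘ₗ (mk ℤ A A).flip (e r)) (c • e p) = 0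
        rw [map_smul]
        change c • Φ (e q ⊗ₜ (e p ⊗ₜ e r)) = 0
        rw [hΦ]
        exact (key p c hx q r).2.1
    have h₃ : N ≤ LinearMap.ker (Φ ∘ₗ mk ℤ A (A ⊗[ℤ] A) y ∘ₗ mk ℤ A A z) := by
      refine he.trans (Submodule.span_le.2 ?_)
      rintro _ ⟨hx, p, c, rfl⟩
      change Φ (y ⊗ₜ (z ⊗ₜ (c • e p))) = 0
      refine eq_zero_of_basis e (fun y => Φ (y ⊗ₜ (z ⊗ₜ (c • e p)))) ?_ (fun q =>
        eq_zero_of_basis e (fun z => Φ (e q ⊗ₜ (z ⊗ₜ (c • e p)))) ?_ (fun r => ?_) z) y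
      · intro a b; simp only [add_tmul, map_add]
      · intro a b; simp only [add_tmul, tmul_add, map_add]
      · change (Φ ∘ₗ mk ℤ A (A ⊗[ℤ] A) (e q) ∘ₗ mk ℤ A A (e r)) (c • e p) = 0
        rw [map_smul]
        change c • Φ (e q ⊗ₜ (e r ⊗ₜ e p)) = 0
        rw [hΦ]
        exact (key p c hx q r).2.2
    exact ⟨h₁ hx, h₂ hx, h₃ hx⟩

end Smith

end GenDimension

end

/-! ### Commutator calculus, multilinear maps on the abelianization, and vanishing of the Magnus
components -/

noncomputable section

namespace GenDimension

open MonoidAlgebra TensorProduct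
open scoped commutatorElement

section Commutators

variable {G : Type*} [Group G]

theorem commutatorElement_mul_right (u c d : G) : ⁅u, c * d⁆ = ⁅u, c⁆ * (c * ⁅u, d⁆ * c⁻¹) := by
  simp only [commutatorElement_def]; group

theorem commutatorElement_mul_left (u v c : G) : ⁅u * v, c⁆ = u * ⁅v, c⁆ * u⁻¹ * ⁅u, c⁆ := by
  simp only [commutatorElement_def]; group

theorem commutatorElement_mul_right_of_mem_center {u c d : G}
    (h : ⁅u, d⁆ ∈ Subgroup.center G) : ⁅u, c * d⁆ = ⁅u, c⁆ * ⁅u, d⁆ := by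
  rw [commutatorElement_mul_right, Subgroup.mem_center_iff.1 h c, mul_inv_cancel_right]

theorem commutatorElement_mul_left_of_mem_center {u v c : G}
    (h : ⁅v, c⁆ ∈ Subgroup.center G) : ⁅u * v, c⁆ = ⁅u, c⁆ * ⁅v, c⁆ := by
  rw [commutatorElement_mul_left, Subgroup.mem_center_iff.1 h u, mul_inv_cancel_right,
    Subgroup.mem_center_iff.1 h]

theorem commutatorElement_inv_left_of_mem_center {u c : G}
    (h : ⁅u, c⁆ ∈ Subgroup.center G) : ⁅u⁻¹, c⁆ = ⁅u, c⁆⁻¹ := by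
  have := commutatorElement_mul_left_of_mem_center (u := u⁻¹) h
  rw [inv_mul_cancel, commutatorElement_one_left] at this
  exact eq_inv_of_mul_eq_one_left this.symm

theorem commutatorElement_mul_left_of_mem_center' {z v c : G} (h : z ∈ Subgroup.center G) :
    ⁅z * v, c⁆ = ⁅v, c⁆ := by
  have hz : ⁅z, c⁆ = 1 := commutatorElement_eq_one_iff_mul_comm.2
    (Subgroup.mem_center_iff.1 h c).symm
  rw [commutatorElement_mul_left, hz, mul_one, ← Subgroup.mem_center_iff.1 h,
    mul_inv_cancel_right]

/-- The Hall–Witt identity. -/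
theorem hall_witt (x y z : G) :
    ⁅⁅x, y⁆, y * z * y⁻¹⁆ * ⁅⁅y, z⁆, z * x * z⁻¹⁆ * ⁅⁅z, x⁆, x * y * x⁻¹⁆ = 1 := by
  simp only [commutatorElement_def]; group

theorem tripleCommutator_mul_right (hG : ∀ a b c : G, ⁅⁅a, b⁆, c⁆ ∈ Subgroup.center G)
    (a b c d : G) :
    ⁅⁅a, b⁆, c * d⁆ = ⁅⁅a, b⁆, c⁆ * ⁅⁅a, b⁆, d⁆ :=
  commutatorElement_mul_right_of_mem_center (hG _ _ _)

/-- Conjugating [b, c] by a changes it by a triple commutator, which is central and so disappears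
inside the outer commutator. -/
theorem tripleCommutator_mul_left (hG : ∀ a b c : G, ⁅⁅a, b⁆, c⁆ ∈ Subgroup.center G)
    (a b c d : G) :
    ⁅⁅a * b, c⁆, d⁆ = ⁅⁅a, c⁆, d⁆ * ⁅⁅b, c⁆, d⁆ := by
  have h : a * ⁅b, c⁆ * a⁻¹ = ⁅⁅b, c⁆, a⁆⁻¹ * ⁅b, c⁆ := by
    simp only [commutatorElement_def]; group
  rw [commutatorElement_mul_left, h, mul_assoc,
    commutatorElement_mul_left_of_mem_center' (inv_mem (hG _ _ _)),
    commutatorElement_mul_left_of_mem_center (hG _ _ _), Subgroup.mem_center_iff.1 (hG a c d)]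

theorem tripleCommutator_swap (hG : ∀ a b c : G, ⁅⁅a, b⁆, c⁆ ∈ Subgroup.center G)
    (a b c : G) : ⁅⁅b, a⁆, c⁆ = ⁅⁅a, b⁆, c⁆⁻¹ := by
  rw [← commutatorElement_inv a b, commutatorElement_inv_left_of_mem_center (hG _ _ _)]

theorem tripleCommutator_mul_middle (hG : ∀ a b c : G, ⁅⁅a, b⁆, c⁆ ∈ Subgroup.center G)
    (a b c d : G) :
    ⁅⁅a, b * c⁆, d⁆ = ⁅⁅a, b⁆, d⁆ * ⁅⁅a, c⁆, d⁆ := by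
  rw [tripleCommutator_swap hG, tripleCommutator_mul_left hG, mul_inv_rev,
    ← tripleCommutator_swap hG c a, ← tripleCommutator_swap hG b a,
    Subgroup.mem_center_iff.1 (hG a b d)]

theorem tripleCommutator_conj (hG : ∀ a b c : G, ⁅⁅a, b⁆, c⁆ ∈ Subgroup.center G)
    (a b c d : G) : ⁅⁅a, b⁆, d * c * d⁻¹⁆ = ⁅⁅a, b⁆, c⁆ := by
  have h := tripleCommutator_mul_right hG a b (d * c * d⁻¹) d
  rw [inv_mul_cancel_right, tripleCommutator_mul_right hG] at h
  rw [Subgroup.mem_center_iff.1 (hG a b c)] at h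
  exact (mul_right_cancel h).symm

/-- This is the Hall–Witt identity, whose conjugations in the outer entries have no effect when
triple commutators are central. -/
theorem tripleCommutator_jacobi (hG : ∀ a b c : G, ⁅⁅a, b⁆, c⁆ ∈ Subgroup.center G)
    (a b c : G) :
    ⁅⁅a, b⁆, c⁆ * ⁅⁅b, c⁆, a⁆ * ⁅⁅c, a⁆, b⁆ = 1 := by
  have h := hall_witt a b c
  rwa [tripleCommutator_conj hG, tripleCommutator_conj hG, tripleCommutator_conj hG] at h

end Commutators

variable {F : Type*} [Group F]

/-- An additive function on `F` factors through the abelianization. -/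
def abLift {P : Type*} [AddCommGroup P] (f : F → P) (hf : ∀ g h, f (g * h) = f g + f h) :
    Ab F →ₗ[ℤ] P :=
  (MonoidHom.toAdditiveLeft (Abelianization.lift
    (MonoidHom.mk' (fun g => Multiplicative.ofAdd (f g)) hf))).toIntLinearMap

theorem Ab.linearMap_ext {P : Type*} [AddCommGroup P] {f g : Ab F →ₗ[ℤ] P}
    (h : ∀ x, f (toAb x) = g (toAb x)) : f = g := by
  ext a
  obtain ⟨x, rfl⟩ := toAb_surjective a
  exact h x

/-- A biadditive function on `F` factors through the abelianization. -/
def abLift₂ {P : Type*} [AddCommGroup P] (f : F → F → P)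
    (h₁ : ∀ g g' h, f (g * g') h = f g h + f g' h)
    (h₂ : ∀ g h h', f g (h * h') = f g h + f g h') : Ab F →ₗ[ℤ] Ab F →ₗ[ℤ] P :=
  abLift (fun g => abLift (f g) (h₂ g)) fun g g' => Ab.linearMap_ext fun h => h₁ g g' h

/-- A triadditive function on `F` factors through the abelianization. -/
def abLift₃ {P : Type*} [AddCommGroup P] (f : F → F → F → P)
    (h₁ : ∀ g g' h k, f (g * g') h k = f g h k + f g' h k)
    (h₂ : ∀ g h h' k, f g (h * h') k = f g h k + f g h' k)
    (h₃ : ∀ g h k k', f g h (k * k') = f g h k + f g h k') :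
    Ab F →ₗ[ℤ] Ab F →ₗ[ℤ] Ab F →ₗ[ℤ] P :=
  abLift (fun g => abLift₂ (f g) (h₂ g) (h₃ g)) fun g g' => Ab.linearMap_ext fun h =>
    Ab.linearMap_ext fun k => h₁ g g' h k

namespace MagnusMaps

variable (M : MagnusMaps F)

theorem θ₁_eq_zero {u : MonoidAlgebra ℤ F} (hu : u ∈ augIdeal F ^ 2) : M.θ₁ u = 0 := by
  rw [pow_two] at hu
  induction hu using Submodule.mul_induction_on' with
  | mem_mul_mem a ha b hb => exact M.θ₁_mul ha hb
  | add a _ b _ ha hb => rw [map_add, ha, hb, add_zero]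

theorem augIdeal_pow_le {n : ℕ} (hn : 1 ≤ n) : augIdeal F ^ n ≤ augIdeal F := by
  simpa using augIdeal_pow_antitone (F := F) le_rfl hn

theorem θ₂_eq_zero {u : MonoidAlgebra ℤ F} (hu : u ∈ augIdeal F ^ 3) : M.θ₂ u = 0 := by
  rw [pow_succ] at hu
  induction hu using Submodule.mul_induction_on' with
  | mem_mul_mem a ha b hb =>
    rw [M.θ₂_mul (augIdeal_pow_le one_le_two ha) hb, M.θ₁_eq_zero ha, zero_tmul]
  | add a _ b _ ha hb => rw [map_add, ha, hb, add_zero]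

theorem θ₃_eq_zero {u : MonoidAlgebra ℤ F} (hu : u ∈ augIdeal F ^ 4) : M.θ₃ u = 0 := by
  rw [pow_succ, pow_succ] at hu
  induction hu using Submodule.mul_induction_on' with
  | mem_mul_mem a ha b hb =>
    induction ha using Submodule.mul_induction_on' with
    | mem_mul_mem a ha c hc =>
      rw [M.θ₃_mul (augIdeal_pow_le one_le_two ha) hc hb, M.θ₁_eq_zero ha, zero_tmul]
    | add a _ c _ ha hc => rw [add_mul, map_add, ha, hc, add_zero]
  | add a _ b _ ha hb => rw [map_add, ha, hb, add_zero]

end MagnusMaps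

end GenDimension

end

/-! ### Reading elements of γ₂(F) and γ₃(F) off their Magnus components -/

noncomputable section

namespace GenDimension

open MonoidAlgebra TensorProduct
open scoped commutatorElement IsMulCommutative

variable {F : Type*} [Group F]

theorem of_sub_one_mem_sq {g : F} (hg : g ∈ (⊤ : Subgroup F).lowerCentralSeries 1) :
    of ℤ F g - 1 ∈ augIdeal F ^ 2 := of_sub_one_mem_augIdeal_pow hg

theorem augIdeal_mul_mem {k m n : ℕ} (hk : 1 ≤ k) (hkmn : k ≤ m + n) {u v : MonoidAlgebra ℤ F}
    (hu : u ∈ augIdeal F ^ m) (hv : v ∈ augIdeal F ^ n) : u * v ∈ augIdeal F ^ k := by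
  refine augIdeal_pow_antitone hk hkmn ?_
  rw [pow_add]
  exact Submodule.mul_mem_mul hu hv

theorem of_sub_one_mem_pow_one (g : F) : of ℤ F g - 1 ∈ augIdeal F ^ 1 := by
  rw [pow_one]
  exact of_sub_one_mem_augIdeal g

/-- The commutator `(g - 1)(h - 1) - (h - 1)(g - 1)` in the group ring. -/
def ringCommutator (g h : F) : MonoidAlgebra ℤ F :=
  (of ℤ F g - 1) * (of ℤ F h - 1) - (of ℤ F h - 1) * (of ℤ F g - 1)

theorem ringCommutator_mem {g h : F} {n : ℕ}
    (hg : g ∈ (⊤ : Subgroup F).lowerCentralSeries n) :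
    ringCommutator g h ∈ augIdeal F ^ (n + 2) := by
  have h₁ := of_sub_one_mem_augIdeal_pow hg
  have h₂ := of_sub_one_mem_pow_one h
  exact sub_mem (augIdeal_mul_mem (by omega) (by omega) h₁ h₂)
    (augIdeal_mul_mem (by omega) (by omega) h₂ h₁)

/-- Modulo `𝔣 ^ (n + 3)`, the group commutator of `g ∈ γ_{n+1}(F)` with `h` is the ring
commutator. -/
theorem commutator_sub_ringCommutator_mem {g h : F} {n : ℕ}
    (hg : g ∈ (⊤ : Subgroup F).lowerCentralSeries n) :
    of ℤ F ⁅g, h⁆ - 1 - ringCommutator g h ∈ augIdeal F ^ (n + 3) := by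
  rw [of_commutator_sub_one]
  change ringCommutator g h * _ + ringCommutator g h - _ ∈ _
  rw [add_sub_cancel_right]
  exact augIdeal_mul_mem (by omega) (by omega) (ringCommutator_mem hg) (of_sub_one_mem_pow_one _)

variable {G : Type*} [Group G]

/-- A linear map on `ℤ[F]` that vanishes on the products `(g - 1)(h - 1)` with `g`, `h` in a term of
the lower central series describes a homomorphism on that term as soon as it does so on the
generating commutators. -/
theorem eq_of_eq_on_generators {P : Type*} [AddCommGroup P] (j : P → G)
    (hj : ∀ a b, j (a + b) = j a * j b)
    (π : F →* G) (Ψ : MonoidAlgebra ℤ F →ₗ[ℤ] P) {n : ℕ}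
    (hΨ : ∀ g ∈ (⊤ : Subgroup F).lowerCentralSeries (n + 1),
      ∀ h ∈ (⊤ : Subgroup F).lowerCentralSeries (n + 1),
        Ψ ((of ℤ F g - 1) * (of ℤ F h - 1)) = 0)
    (h : ∀ g ∈ (⊤ : Subgroup F).lowerCentralSeries n, ∀ h : F,
      π ⁅g, h⁆ = j (Ψ (of ℤ F ⁅g, h⁆ - 1)))
    {w : F} (hw : w ∈ (⊤ : Subgroup F).lowerCentralSeries (n + 1)) :
    π w = j (Ψ (of ℤ F w - 1)) := by
  have j0 : j 0 = 1 := by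
    have := hj 0 0
    rw [add_zero] at this
    exact left_eq_mul.1 this
  rw [Subgroup.mem_lowerCentralSeries_succ_iff] at hw
  induction hw using Subgroup.closure_induction with
  | mem x hx =>
    obtain ⟨p, hp, q, -, rfl⟩ := hx
    exact h p hp q
  | one => rw [map_one, map_one, sub_self, map_zero, j0]
  | mul x y hx hy hx' hy' =>
    rw [of_mul_sub_one, map_add, map_add, hΨ x hx y hy, zero_add, hj, map_mul, hx', hy']
  | inv x hx hx' =>
    rw [of_inv_sub_one, map_sub, map_neg, hΨ _ (inv_mem hx) x hx, neg_zero, zero_sub, map_inv,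
      hx', inv_eq_iff_mul_eq_one, ← hj, add_neg_cancel, j0]

namespace MagnusMaps

variable (M : MagnusMaps F)

theorem θ₂_ringCommutator (g h : F) :
    M.θ₂ (ringCommutator g h) = toAb g ⊗ₜ toAb h - toAb h ⊗ₜ toAb g := by
  rw [ringCommutator, map_sub, M.θ₂_mul (of_sub_one_mem_augIdeal g) (of_sub_one_mem_augIdeal h),
    M.θ₂_mul (of_sub_one_mem_augIdeal h) (of_sub_one_mem_augIdeal g), θ₁_of_sub_one,
    θ₁_of_sub_one]

theorem θ₂_commutator (g h : F) :
    M.θ₂ (of ℤ F ⁅g, h⁆ - 1) = toAb g ⊗ₜ toAb h - toAb h ⊗ₜ toAb g := by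
  rw [← θ₂_ringCommutator, ← sub_eq_zero, ← map_sub]
  exact M.θ₂_eq_zero (commutator_sub_ringCommutator_mem (n := 0) (Subgroup.mem_top g))

theorem θ₃_commutator {g : F} (hg : g ∈ (⊤ : Subgroup F).lowerCentralSeries 1) (h : F) :
    M.θ₃ (of ℤ F ⁅g, h⁆ - 1) = M.θ₃ (ringCommutator g h) := by
  rw [← sub_eq_zero, ← map_sub]
  exact M.θ₃_eq_zero (commutator_sub_ringCommutator_mem hg)

/-- Replacing [g, h] - 1 by the ring commutator costs an error d ∈ 𝔣³, which contributes only to 𝔣⁴;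
what remains is the expanded double ring commutator. -/
theorem θ₃_ringCommutator_commutator (g h k : F) :
    M.θ₃ (ringCommutator ⁅g, h⁆ k) =
      toAb g ⊗ₜ (toAb h ⊗ₜ toAb k) - toAb h ⊗ₜ (toAb g ⊗ₜ toAb k) -
        toAb k ⊗ₜ (toAb g ⊗ₜ toAb h) + toAb k ⊗ₜ (toAb h ⊗ₜ toAb g) := by
  have hg := of_sub_one_mem_augIdeal g
  have hh := of_sub_one_mem_augIdeal h
  have hk := of_sub_one_mem_augIdeal k
  set d := of ℤ F ⁅g, h⁆ - 1 - ringCommutator g h with hd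
  have hd3 : d ∈ augIdeal F ^ 3 :=
    commutator_sub_ringCommutator_mem (n := 0) (Subgroup.mem_top g)
  have e : ringCommutator ⁅g, h⁆ k =
      (of ℤ F g - 1) * (of ℤ F h - 1) * (of ℤ F k - 1) -
      (of ℤ F h - 1) * (of ℤ F g - 1) * (of ℤ F k - 1) -
      (of ℤ F k - 1) * (of ℤ F g - 1) * (of ℤ F h - 1) +
      (of ℤ F k - 1) * (of ℤ F h - 1) * (of ℤ F g - 1) +
      (d * (of ℤ F k - 1) - (of ℤ F k - 1) * d) := by
    have : of ℤ F ⁅g, h⁆ - 1 = d + ((of ℤ F g - 1) * (of ℤ F h - 1) -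
        (of ℤ F h - 1) * (of ℤ F g - 1)) := by
      rw [hd, ringCommutator, sub_add_cancel]
    rw [ringCommutator, this]
    generalize of ℤ F g - 1 = x
    generalize of ℤ F h - 1 = y
    generalize of ℤ F k - 1 = z
    simp only [add_mul, mul_add, sub_mul, mul_sub, mul_assoc]
    abel
  have hz : M.θ₃ (d * (of ℤ F k - 1) - (of ℤ F k - 1) * d) = 0 :=
    M.θ₃_eq_zero (sub_mem (augIdeal_mul_mem (by omega) le_rfl hd3 (of_sub_one_mem_pow_one k))
      (augIdeal_mul_mem (by omega) le_rfl (of_sub_one_mem_pow_one k) hd3))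
  rw [e, map_add, hz, add_zero, map_add, map_sub, map_sub, M.θ₃_mul hg hh hk,
    M.θ₃_mul hh hg hk, M.θ₃_mul hk hg hh, M.θ₃_mul hk hh hg]
  simp only [θ₁_of_sub_one]

theorem map_eq_θ₂ (π : F →* G)
    (Φ : Ab F ⊗[ℤ] Ab F →ₗ[ℤ] Additive (Subgroup.center G))
    (hΦ : ∀ g h, ((Φ (toAb g ⊗ₜ toAb h - toAb h ⊗ₜ toAb g)).toMul : G) = ⁅π g, π h⁆)
    {w : F} (hw : w ∈ (⊤ : Subgroup F).lowerCentralSeries 1) :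
    π w = ((Φ (M.θ₂ (of ℤ F w - 1))).toMul : G) := by
  refine eq_of_eq_on_generators (fun a : Additive (Subgroup.center G) => (a.toMul : G))
    (fun a b => rfl) π (Φ ∘ₗ M.θ₂) (n := 0) (fun g hg h hh => ?_) (fun g _ h => ?_) hw
  · rw [LinearMap.comp_apply, M.θ₂_eq_zero, map_zero]
    exact augIdeal_mul_mem (by omega) (by omega) (of_sub_one_mem_sq hg) (of_sub_one_mem_sq hh)
  · rw [LinearMap.comp_apply, θ₂_commutator, hΦ, map_commutatorElement]

/-- γ₃(F) is generated by the [u, k] with u anywhere in γ₂(F), whereas `hΦ` covers only u = [g, h].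
The general case follows because both sides are multiplicative in u, the quadratic error terms
falling into 𝔣⁴. -/
theorem map_commutator_eq_θ₃ (π : F →* G)
    (Φ : Ab F ⊗[ℤ] (Ab F ⊗[ℤ] Ab F) →ₗ[ℤ] Additive (Subgroup.center G))
    (hΦ : ∀ g h k, ((Φ (toAb g ⊗ₜ (toAb h ⊗ₜ toAb k) - toAb h ⊗ₜ (toAb g ⊗ₜ toAb k) -
        toAb k ⊗ₜ (toAb g ⊗ₜ toAb h) + toAb k ⊗ₜ (toAb h ⊗ₜ toAb g))).toMul : G) =
      ⁅⁅π g, π h⁆, π k⁆)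
    {u : F} (hu : u ∈ (⊤ : Subgroup F).lowerCentralSeries 1) (k : F) :
    ⁅π u, π k⁆ = ((Φ (M.θ₃ (ringCommutator u k))).toMul : G) := by
  have hk := of_sub_one_mem_pow_one k
  have hzero : ∀ x ∈ (⊤ : Subgroup F).lowerCentralSeries 1,
      ∀ y ∈ (⊤ : Subgroup F).lowerCentralSeries 1,
      M.θ₃ ((of ℤ F x - 1) * (of ℤ F y - 1) * (of ℤ F k - 1) -
        (of ℤ F k - 1) * ((of ℤ F x - 1) * (of ℤ F y - 1))) = 0 := fun x hx y hy => by
    have hxy := augIdeal_mul_mem (by omega) le_rfl (of_sub_one_mem_sq hx) (of_sub_one_mem_sq hy)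
    exact M.θ₃_eq_zero (sub_mem (augIdeal_mul_mem (by omega) (by omega) hxy hk)
      (augIdeal_mul_mem (by omega) (by omega) hk hxy))
  rw [Subgroup.mem_lowerCentralSeries_succ_iff] at hu
  induction hu using Subgroup.closure_induction with
  | mem x hx =>
    obtain ⟨p, -, q, -, rfl⟩ := hx
    rw [θ₃_ringCommutator_commutator, map_commutatorElement]
    exact (hΦ p q k).symm
  | one =>
    rw [map_one, commutatorElement_one_left, ringCommutator, map_one, sub_self, zero_mul, mul_zero,
      sub_self, map_zero, map_zero]
    rfl
  | mul x y hx hy hx' hy' =>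
    have e : ringCommutator (x * y) k = ((of ℤ F x - 1) * (of ℤ F y - 1) * (of ℤ F k - 1) -
        (of ℤ F k - 1) * ((of ℤ F x - 1) * (of ℤ F y - 1))) +
        (ringCommutator x k + ringCommutator y k) := by
      simp only [ringCommutator, of_mul_sub_one, add_mul, mul_add]
      abel
    -- The centrality needed to split the commutator comes from the induction hypothesis, whose
    -- right side is a central element.
    rw [e, map_add, hzero x hx y hy, zero_add, map_add, map_add, map_mul,
      commutatorElement_mul_left_of_mem_center (by rw [hy']; exact Subtype.prop _), hx', hy']
    rfl
  | inv x hx hx' =>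
    have e : ringCommutator x⁻¹ k = -((of ℤ F x⁻¹ - 1) * (of ℤ F x - 1) * (of ℤ F k - 1) -
        (of ℤ F k - 1) * ((of ℤ F x⁻¹ - 1) * (of ℤ F x - 1))) - ringCommutator x k := by
      have ha := of_inv_sub_one x
      rw [ringCommutator, ringCommutator]
      generalize of ℤ F x⁻¹ - 1 = a at ha ⊢
      generalize of ℤ F x - 1 = b at ha ⊢
      generalize of ℤ F k - 1 = c
      calc a * c - c * a = (-(a * b) - b) * c - c * (-(a * b) - b) := by rw [← ha]
        _ = _ := by noncomm_ring
    rw [e, map_sub, map_neg, hzero _ (inv_mem hx) x hx, neg_zero, zero_sub, map_neg, map_inv,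
      commutatorElement_inv_left_of_mem_center (by rw [hx']; exact Subtype.prop _), hx']
    rfl

theorem map_eq_θ₃ (π : F →* G)
    (Φ : Ab F ⊗[ℤ] (Ab F ⊗[ℤ] Ab F) →ₗ[ℤ] Additive (Subgroup.center G))
    (hΦ : ∀ g h k, ((Φ (toAb g ⊗ₜ (toAb h ⊗ₜ toAb k) - toAb h ⊗ₜ (toAb g ⊗ₜ toAb k) -
        toAb k ⊗ₜ (toAb g ⊗ₜ toAb h) + toAb k ⊗ₜ (toAb h ⊗ₜ toAb g))).toMul : G) =
      ⁅⁅π g, π h⁆, π k⁆)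
    {w : F} (hw : w ∈ (⊤ : Subgroup F).lowerCentralSeries 2) :
    π w = ((Φ (M.θ₃ (of ℤ F w - 1))).toMul : G) := by
  refine eq_of_eq_on_generators (fun a : Additive (Subgroup.center G) => (a.toMul : G))
    (fun a b => rfl) π (Φ ∘ₗ M.θ₃) (n := 1) (fun g hg h hh => ?_) (fun g hg h => ?_) hw
  · rw [LinearMap.comp_apply, M.θ₃_eq_zero, map_zero]
    exact augIdeal_mul_mem (by omega) (by omega) (of_sub_one_mem_augIdeal_pow hg)
      (of_sub_one_mem_augIdeal_pow hh)
  · rw [LinearMap.comp_apply, M.θ₃_commutator hg, ← M.map_commutator_eq_θ₃ π Φ hΦ hg,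
      map_commutatorElement]

end MagnusMaps

end GenDimension

end

/-! ### From tensors over the image of R to membership in γ₂(R)γ₃(F) and Rγ₄(F) -/

noncomputable section

namespace GenDimension

open MonoidAlgebra TensorProduct
open scoped commutatorElement IsMulCommutative

variable {F : Type*} [Group F]

/-- The image of a subgroup in the abelianization. -/
def abImage (R : Subgroup F) : Submodule ℤ (Ab F) :=
  AddSubgroup.toIntSubmodule (Subgroup.toAddSubgroup (R.map Abelianization.of))

theorem mem_abImage {R : Subgroup F} {a : Ab F} : a ∈ abImage R ↔ ∃ r ∈ R, toAb r = a := Iff.rfl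

section TensorSubmodules

variable {A : Type*} [AddCommGroup A]

/-- The image of `N ⊗ N` in `A ⊗ A`. -/
def tensorSq (N : Submodule ℤ A) : Submodule ℤ (A ⊗[ℤ] A) :=
  Submodule.span ℤ {t | ∃ x ∈ N, ∃ y ∈ N, t = x ⊗ₜ y}

/-- The part of degree three of the ideal generated by `N` in the tensor algebra of `A`. -/
def tensorIdeal (N : Submodule ℤ A) : Submodule ℤ (A ⊗[ℤ] (A ⊗[ℤ] A)) :=
  Submodule.span ℤ {t | ∃ x y z, t = x ⊗ₜ (y ⊗ₜ z) ∧ (x ∈ N ∨ y ∈ N ∨ z ∈ N)}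

theorem tensorSq_mono {N N' : Submodule ℤ A} (h : N ≤ N') : tensorSq N ≤ tensorSq N' := by
  refine Submodule.span_mono ?_
  rintro _ ⟨x, hx, y, hy, rfl⟩
  exact ⟨x, h hx, y, h hy, rfl⟩

theorem tensorIdeal_mono {N N' : Submodule ℤ A} (h : N ≤ N') :
    tensorIdeal N ≤ tensorIdeal N' := by
  refine Submodule.span_mono ?_
  rintro _ ⟨x, y, z, rfl, hN⟩
  exact ⟨x, y, z, rfl, hN.imp (@h x) (Or.imp (@h y) (@h z))⟩

theorem exists_fg_mem_tensorSq {N : Submodule ℤ A} {t : A ⊗[ℤ] A} (ht : t ∈ tensorSq N) :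
    ∃ N' ≤ N, N'.FG ∧ t ∈ tensorSq N' := by
  induction ht using Submodule.span_induction with
  | mem t ht =>
    obtain ⟨x, hx, y, hy, rfl⟩ := ht
    refine ⟨Submodule.span ℤ {x, y}, Submodule.span_le.2 ?_, Submodule.fg_span (by simp),
      Submodule.subset_span ⟨x, Submodule.subset_span (by simp), y,
        Submodule.subset_span (by simp), rfl⟩⟩
    rintro _ (rfl | rfl)
    exacts [hx, hy]
  | zero => exact ⟨⊥, bot_le, Submodule.fg_bot, zero_mem _⟩
  | add s t _ _ hs ht =>
    obtain ⟨N₁, h₁, hf₁, hs⟩ := hs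
    obtain ⟨N₂, h₂, hf₂, ht⟩ := ht
    exact ⟨N₁ ⊔ N₂, sup_le h₁ h₂, hf₁.sup hf₂,
      add_mem (tensorSq_mono le_sup_left hs) (tensorSq_mono le_sup_right ht)⟩
  | smul c t _ ht =>
    obtain ⟨N₁, h₁, hf₁, ht⟩ := ht
    exact ⟨N₁, h₁, hf₁, Submodule.smul_mem _ c ht⟩

theorem exists_fg_mem_tensorIdeal {N : Submodule ℤ A} {t : A ⊗[ℤ] (A ⊗[ℤ] A)}
    (ht : t ∈ tensorIdeal N) : ∃ N' ≤ N, N'.FG ∧ t ∈ tensorIdeal N' := by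
  have hs : ∀ {x}, x ∈ Submodule.span ℤ {x} := fun {x : A} => Submodule.mem_span_singleton_self x
  have hle : ∀ {x}, x ∈ N → Submodule.span ℤ {x} ≤ N := fun hx =>
    (Submodule.span_singleton_le_iff_mem _ _).2 hx
  induction ht using Submodule.span_induction with
  | mem t ht =>
    obtain ⟨x, y, z, rfl, h | h | h⟩ := ht
    · exact ⟨_, hle h, Submodule.fg_span_singleton _,
        Submodule.subset_span ⟨x, y, z, rfl, Or.inl hs⟩⟩
    · exact ⟨_, hle h, Submodule.fg_span_singleton _,
        Submodule.subset_span ⟨x, y, z, rfl, Or.inr (Or.inl hs)⟩⟩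
    · exact ⟨_, hle h, Submodule.fg_span_singleton _,
        Submodule.subset_span ⟨x, y, z, rfl, Or.inr (Or.inr hs)⟩⟩
  | zero => exact ⟨⊥, bot_le, Submodule.fg_bot, zero_mem _⟩
  | add s t _ _ hs ht =>
    obtain ⟨N₁, h₁, hf₁, hs⟩ := hs
    obtain ⟨N₂, h₂, hf₂, ht⟩ := ht
    exact ⟨N₁ ⊔ N₂, sup_le h₁ h₂, hf₁.sup hf₂,
      add_mem (tensorIdeal_mono le_sup_left hs) (tensorIdeal_mono le_sup_right ht)⟩
  | smul c t _ ht =>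
    obtain ⟨N₁, h₁, hf₁, ht⟩ := ht
    exact ⟨N₁, h₁, hf₁, Submodule.smul_mem _ c ht⟩

end TensorSubmodules

/-- An element of `γ₂(F)` whose class in `A ⊗ A` comes from `B ⊗ B`, with `B` the image of `R`,
lies in `γ₂(R) γ₃(F)`. -/
theorem mem_of_θ₂_mem_tensorSq [IsFreeGroup F] (M : MagnusMaps F) (R : Subgroup F) [R.Normal]
    {w : F} (hw : w ∈ (⊤ : Subgroup F).lowerCentralSeries 1)
    (h : M.θ₂ (of ℤ F w - 1) ∈ tensorSq (abImage R)) :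
    w ∈ R.lowerCentralSeries 1 ⊔ (⊤ : Subgroup F).lowerCentralSeries 2 := by
  have hn : (R.lowerCentralSeries 1).Normal := by
    change (⁅R, R⁆ : Subgroup F).Normal
    infer_instance
  set N := R.lowerCentralSeries 1 ⊔ (⊤ : Subgroup F).lowerCentralSeries 2 with hN
  let π := QuotientGroup.mk' N
  have hπ : ∀ {x}, π x = 1 ↔ x ∈ N := fun {x} => QuotientGroup.eq_one_iff (N := N) x
  have hc : ∀ a b : F ⧸ N, ⁅a, b⁆ ∈ Subgroup.center (F ⧸ N) := by
    intro a b
    rw [Subgroup.mem_center_iff]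
    intro c
    obtain ⟨a, rfl⟩ := QuotientGroup.mk'_surjective N a
    obtain ⟨b, rfl⟩ := QuotientGroup.mk'_surjective N b
    obtain ⟨c, rfl⟩ := QuotientGroup.mk'_surjective N c
    have : π ⁅⁅a, b⁆, c⁆ = 1 := hπ.2 (le_sup_right (α := Subgroup F)
      (Subgroup.commutator_mem_commutator (Subgroup.commutator_mem_commutator
        (Subgroup.mem_top a) (Subgroup.mem_top b)) (Subgroup.mem_top c)))
    rw [map_commutatorElement, map_commutatorElement] at this
    exact (commutatorElement_eq_one_iff_mul_comm.1 this).symm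
  let f : F → F → Additive (Subgroup.center (F ⧸ N)) := fun g h =>
    Additive.ofMul ⟨⁅π g, π h⁆, hc _ _⟩
  let κ := abLift₂ f
    (fun g g' h => congr_arg Additive.ofMul (Subtype.ext (by
      rw [map_mul]; exact commutatorElement_mul_left_of_mem_center (hc _ _))))
    (fun g h h' => congr_arg Additive.ofMul (Subtype.ext (by
      rw [map_mul]; exact commutatorElement_mul_right_of_mem_center (hc _ _))))
  obtain ⟨B, hBR, hB, hwB⟩ := exists_fg_mem_tensorSq h
  obtain ⟨Φ, hΦ, hΦB⟩ := exists_linearMap_wedge_two B hB κ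
    (fun a => by
      obtain ⟨g, rfl⟩ := toAb_surjective a
      exact congr_arg Additive.ofMul (Subtype.ext (commutatorElement_self _)))
    (fun x hx y hy => by
      obtain ⟨r, hr, rfl⟩ := hBR hx
      obtain ⟨s, hs, rfl⟩ := hBR hy
      refine congr_arg Additive.ofMul (Subtype.ext ?_)
      change ⁅π r, π s⁆ = 1
      rw [← map_commutatorElement, hπ]
      exact le_sup_left (α := Subgroup F) (Subgroup.commutator_mem_commutator hr hs))
  have key := M.map_eq_θ₂ π Φ (fun g h => by rw [hΦ]; rfl) hw
  have hle : tensorSq B ≤ LinearMap.ker Φ := by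
    refine Submodule.span_le.2 ?_
    rintro _ ⟨x, hx, y, hy, rfl⟩
    exact hΦB x hx y hy
  rw [← hπ, key, show Φ _ = 0 from hle hwB]
  rfl

/-- An element of `γ₃(F)` whose class in `A ⊗ A ⊗ A` lies in the ideal generated by the image of
`R` lies in `R γ₄(F)`. -/
theorem mem_of_θ₃_mem_tensorIdeal [IsFreeGroup F] (M : MagnusMaps F) (R : Subgroup F) [R.Normal]
    {w : F} (hw : w ∈ (⊤ : Subgroup F).lowerCentralSeries 2)
    (h : M.θ₃ (of ℤ F w - 1) ∈ tensorIdeal (abImage R)) :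
    w ∈ R ⊔ (⊤ : Subgroup F).lowerCentralSeries 3 := by
  set N := R ⊔ (⊤ : Subgroup F).lowerCentralSeries 3 with hN
  let π := QuotientGroup.mk' N
  have hπ : ∀ {x}, π x = 1 ↔ x ∈ N := fun {x} => QuotientGroup.eq_one_iff (N := N) x
  have hc : ∀ a b c : F ⧸ N, ⁅⁅a, b⁆, c⁆ ∈ Subgroup.center (F ⧸ N) := by
    intro a b c
    rw [Subgroup.mem_center_iff]
    intro d
    obtain ⟨a, rfl⟩ := QuotientGroup.mk'_surjective N a
    obtain ⟨b, rfl⟩ := QuotientGroup.mk'_surjective N b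
    obtain ⟨c, rfl⟩ := QuotientGroup.mk'_surjective N c
    obtain ⟨d, rfl⟩ := QuotientGroup.mk'_surjective N d
    have : π ⁅⁅⁅a, b⁆, c⁆, d⁆ = 1 := hπ.2 (le_sup_right (α := Subgroup F)
      (Subgroup.commutator_mem_commutator (Subgroup.commutator_mem_commutator
        (Subgroup.commutator_mem_commutator (Subgroup.mem_top a) (Subgroup.mem_top b))
        (Subgroup.mem_top c)) (Subgroup.mem_top d)))
    rw [map_commutatorElement, map_commutatorElement, map_commutatorElement] at this
    exact (commutatorElement_eq_one_iff_mul_comm.1 this).symm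
  let f : F → F → F → Additive (Subgroup.center (F ⧸ N)) := fun g h k =>
    Additive.ofMul ⟨⁅⁅π g, π h⁆, π k⁆, hc _ _ _⟩
  let κ := abLift₃ f
    (fun g g' h k => congr_arg Additive.ofMul (Subtype.ext (by
      rw [map_mul]; exact tripleCommutator_mul_left hc _ _ _ _)))
    (fun g h h' k => congr_arg Additive.ofMul (Subtype.ext (by
      rw [map_mul]; exact tripleCommutator_mul_middle hc _ _ _ _)))
    (fun g h k k' => congr_arg Additive.ofMul (Subtype.ext (by
      rw [map_mul]; exact tripleCommutator_mul_right hc _ _ _ _)))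
  obtain ⟨B, hBR, hB, hwB⟩ := exists_fg_mem_tensorIdeal h
  obtain ⟨Φ, hΦ, hΦB⟩ := exists_linearMap_lie_three B hB κ
    (fun a c => by
      obtain ⟨g, rfl⟩ := toAb_surjective a
      obtain ⟨k, rfl⟩ := toAb_surjective c
      refine congr_arg Additive.ofMul (Subtype.ext ?_)
      change ⁅⁅π g, π g⁆, π k⁆ = 1
      rw [commutatorElement_self, commutatorElement_one_left])
    (fun a b c => by
      obtain ⟨g, rfl⟩ := toAb_surjective a
      obtain ⟨h, rfl⟩ := toAb_surjective b
      obtain ⟨k, rfl⟩ := toAb_surjective c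
      exact congr_arg Additive.ofMul (Subtype.ext (tripleCommutator_jacobi hc _ _ _)))
    (fun x hx y z => by
      obtain ⟨r, hr, rfl⟩ := hBR hx
      obtain ⟨h, rfl⟩ := toAb_surjective y
      obtain ⟨k, rfl⟩ := toAb_surjective z
      -- Since N contains all of R, one entry from R already kills a triple commutator; so the whole
      -- tensor ideal can be killed, not merely tensors with several entries from R.
      have hr1 : π r = 1 := hπ.2 (le_sup_left (α := Subgroup F) hr)
      constructor
      · refine congr_arg Additive.ofMul (Subtype.ext ?_)
        change ⁅⁅π r, π h⁆, π k⁆ = 1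
        rw [hr1, commutatorElement_one_left, commutatorElement_one_left]
      · refine congr_arg Additive.ofMul (Subtype.ext ?_)
        change ⁅⁅π h, π k⁆, π r⁆ = 1
        rw [hr1, commutatorElement_one_right])
  have key := M.map_eq_θ₃ π Φ (fun g h k => by
    exact congr_arg (fun a : Additive (Subgroup.center (F ⧸ N)) => (a.toMul : F ⧸ N))
      (hΦ (toAb g) (toAb h) (toAb k))) hw
  have hle : tensorIdeal B ≤ LinearMap.ker Φ := by
    refine Submodule.span_le.2 ?_
    rintro _ ⟨x, y, z, rfl, hx | hx | hx⟩
    exacts [(hΦB x hx y z).1, (hΦB y hx x z).2.1, (hΦB z hx x y).2.2]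
  rw [← hπ, key, show Φ _ = 0 from hle hwB]
  rfl

end GenDimension

end

/-! ### The Magnus components of 𝔯² and of 𝔯²𝔣 -/

noncomputable section

namespace GenDimension

open MonoidAlgebra TensorProduct
open scoped commutatorElement

variable {F : Type*} [Group F]

namespace MagnusMaps

variable (M : MagnusMaps F) {R : Subgroup F}

theorem θ₁_mem_abImage {u : MonoidAlgebra ℤ F} (hu : u ∈ relAugIdeal R) :
    M.θ₁ u ∈ abImage R := by
  suffices relAugIdeal R ≤ (abImage R).comap M.θ₁ from this hu
  rw [relAugIdeal_eq_span, Submodule.span_le]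
  rintro _ ⟨r, hr, rfl⟩
  exact mem_abImage.2 ⟨r, hr, (M.θ₁_of_sub_one r).symm⟩

theorem θ₂_mem_tensorSq {u : MonoidAlgebra ℤ F} (hu : u ∈ relAugIdeal R ^ 2) :
    M.θ₂ u ∈ tensorSq (abImage R) := by
  rw [pow_two] at hu
  induction hu using Submodule.mul_induction_on' with
  | mem_mul_mem a ha b hb =>
    rw [M.θ₂_mul (relAugIdeal_le_augIdeal R ha) (relAugIdeal_le_augIdeal R hb)]
    exact Submodule.subset_span ⟨_, M.θ₁_mem_abImage ha, _, M.θ₁_mem_abImage hb, rfl⟩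
  | add a _ b _ ha hb => rw [map_add]; exact add_mem ha hb

theorem θ₃_mem_tensorIdeal_of_mul {u v w : MonoidAlgebra ℤ F} (hu : u ∈ augIdeal F)
    (hv : v ∈ augIdeal F) (hw : w ∈ augIdeal F)
    (h : u ∈ relAugIdeal R ∨ v ∈ relAugIdeal R ∨ w ∈ relAugIdeal R) :
    M.θ₃ (u * v * w) ∈ tensorIdeal (abImage R) := by
  rw [M.θ₃_mul hu hv hw]
  exact Submodule.subset_span ⟨_, _, _, rfl,
    h.imp M.θ₁_mem_abImage (Or.imp M.θ₁_mem_abImage M.θ₁_mem_abImage)⟩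

theorem θ₃_mem_tensorIdeal_of_sq_mul {u v : MonoidAlgebra ℤ F} (hu : u ∈ augIdeal F ^ 2)
    (hv : v ∈ relAugIdeal R) :
    M.θ₃ (u * v) ∈ tensorIdeal (abImage R) ∧ M.θ₃ (v * u) ∈ tensorIdeal (abImage R) := by
  have hv' := relAugIdeal_le_augIdeal R hv
  rw [pow_two] at hu
  induction hu using Submodule.mul_induction_on' with
  | mem_mul_mem a ha b hb =>
    refine ⟨M.θ₃_mem_tensorIdeal_of_mul ha hb hv' (Or.inr (Or.inr hv)), ?_⟩
    rw [← mul_assoc]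
    exact M.θ₃_mem_tensorIdeal_of_mul hv' ha hb (Or.inl hv)
  | add a _ b _ ha hb =>
    rw [add_mul, mul_add, map_add, map_add]
    exact ⟨add_mem ha.1 hb.1, add_mem ha.2 hb.2⟩

theorem θ₃_mem_tensorIdeal_of_relSq_mul {u : MonoidAlgebra ℤ F}
    (hu : u ∈ relAugIdeal R ^ 2 * augIdeal F) : M.θ₃ u ∈ tensorIdeal (abImage R) := by
  rw [pow_two] at hu
  induction hu using Submodule.mul_induction_on' with
  | mem_mul_mem a ha b hb =>
    induction ha using Submodule.mul_induction_on' with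
    | mem_mul_mem a ha c hc =>
      exact M.θ₃_mem_tensorIdeal_of_mul (relAugIdeal_le_augIdeal R ha)
        (relAugIdeal_le_augIdeal R hc) hb (Or.inl ha)
    | add a _ c _ ha hc => rw [add_mul, map_add]; exact add_mem ha hc
  | add a _ b _ ha hb => rw [map_add]; exact add_mem ha hb

/-- The class of `θ₃ ((r - 1)(s - 1))` modulo the ideal generated by the image of `R`. -/
def θ₃Class (R : Subgroup F) (r s : F) :
    (Ab F ⊗[ℤ] (Ab F ⊗[ℤ] Ab F)) ⧸ tensorIdeal (abImage R) :=
  (tensorIdeal (abImage R)).mkQ (M.θ₃ ((of ℤ F r - 1) * (of ℤ F s - 1)))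

theorem θ₃Class_mul_left {r r' s : F} (hr : r ∈ R) :
    M.θ₃Class R (r * r') s = M.θ₃Class R r s + M.θ₃Class R r' s := by
  have h := M.θ₃_mem_tensorIdeal_of_mul (R := R) (of_sub_one_mem_augIdeal r)
    (of_sub_one_mem_augIdeal r') (of_sub_one_mem_augIdeal s)
    (Or.inl (of_sub_one_mem_relAugIdeal hr))
  rw [θ₃Class, θ₃Class, θ₃Class, of_mul_sub_one, add_mul, add_mul, map_add, map_add, map_add,
    map_add, Submodule.mkQ_apply, (Submodule.Quotient.mk_eq_zero _).2 h, zero_add]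

theorem θ₃Class_mul_right {r s s' : F} (hr : r ∈ R) :
    M.θ₃Class R r (s * s') = M.θ₃Class R r s + M.θ₃Class R r s' := by
  have h := M.θ₃_mem_tensorIdeal_of_mul (R := R) (of_sub_one_mem_augIdeal r)
    (of_sub_one_mem_augIdeal s) (of_sub_one_mem_augIdeal s')
    (Or.inl (of_sub_one_mem_relAugIdeal hr))
  rw [θ₃Class, θ₃Class, θ₃Class, of_mul_sub_one, mul_add, mul_add, ← mul_assoc, map_add, map_add,
    map_add, map_add, Submodule.mkQ_apply, (Submodule.Quotient.mk_eq_zero _).2 h, zero_add]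

/-- Two elements with the same class in A differ by a factor in γ₂(F). Its contribution lies in
θ₃(𝔣²𝔯) or θ₃(𝔯𝔣²), hence in the tensor ideal. -/
theorem θ₃Class_congr {r r' s s' : F} (hr' : r' ∈ R) (hs : s ∈ R)
    (hrr : toAb r = toAb r') (hss : toAb s = toAb s') :
    M.θ₃Class R r s = M.θ₃Class R r' s' := by
  have hker : ∀ x y : F, toAb x = toAb y →
      y⁻¹ * x ∈ (⊤ : Subgroup F).lowerCentralSeries 1 := fun x y hxy => by
    have e : toAb y⁻¹ = -toAb y := by
      rw [eq_neg_iff_add_eq_zero, ← toAb_mul, inv_mul_cancel, toAb_one]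
    rw [← toAb_eq_zero_iff, toAb_mul, hxy, e, neg_add_cancel]
  have h₁ : M.θ₃Class R (r'⁻¹ * r) s = 0 :=
    (Submodule.Quotient.mk_eq_zero _).2 (M.θ₃_mem_tensorIdeal_of_sq_mul
      (of_sub_one_mem_sq (hker r r' hrr)) (of_sub_one_mem_relAugIdeal hs)).1
  have h₂ : M.θ₃Class R r' (s'⁻¹ * s) = 0 :=
    (Submodule.Quotient.mk_eq_zero _).2 (M.θ₃_mem_tensorIdeal_of_sq_mul
      (of_sub_one_mem_sq (hker s s' hss)) (of_sub_one_mem_relAugIdeal hr')).2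
  calc M.θ₃Class R r s = M.θ₃Class R (r' * (r'⁻¹ * r)) s := by rw [mul_inv_cancel_left]
    _ = M.θ₃Class R r' (s' * (s'⁻¹ * s)) := by
      rw [θ₃Class_mul_left M hr', h₁, add_zero, mul_inv_cancel_left]
    _ = M.θ₃Class R r' s' := by rw [θ₃Class_mul_right M hr', h₂, add_zero]

/-- Modulo the ideal generated by the image `B` of `R`, the map `θ₃` on `𝔯²` factors through
`B ⊗ B`. -/
theorem exists_bilinear_θ₃Class (R : Subgroup F) :
    ∃ β : abImage R →ₗ[ℤ] abImage R →ₗ[ℤ]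
        (Ab F ⊗[ℤ] (Ab F ⊗[ℤ] Ab F)) ⧸ tensorIdeal (abImage R),
      ∀ r (hr : r ∈ R) s (hs : s ∈ R), β ⟨toAb r, r, hr, rfl⟩ ⟨toAb s, s, hs, rfl⟩ =
        M.θ₃Class R r s := by
  -- σ is only a set-theoretic section; bilinearity comes from `θ₃Class_congr`, which makes the
  -- class independent of the chosen representatives.
  choose σ hσ hσ' using fun a : abImage R => mem_abImage.1 a.2
  have hadd : ∀ a b, toAb (σ (a + b)) = toAb (σ a * σ b) := fun a b => by
    rw [toAb_mul, hσ', hσ', hσ', Submodule.coe_add]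
  refine ⟨(AddMonoidHom.mk' (fun a => (AddMonoidHom.mk' (fun b => M.θ₃Class R (σ a) (σ b))
    fun b c => ?_).toIntLinearMap) fun a b => ?_).toIntLinearMap, fun r hr s hs => ?_⟩
  · rw [← θ₃Class_mul_right M (hσ a)]
    exact M.θ₃Class_congr (hσ a) (hσ _) rfl (hadd b c)
  · ext c
    change M.θ₃Class R (σ (a + b)) (σ c) = M.θ₃Class R (σ a) (σ c) + M.θ₃Class R (σ b) (σ c)
    rw [← θ₃Class_mul_left M (hσ a)]
    exact M.θ₃Class_congr (R.mul_mem (hσ a) (hσ b)) (hσ c) (hadd a b) rfl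
  · exact M.θ₃Class_congr hr (hσ _) (hσ' _) (hσ' _)

/-- If `z ∈ 𝔯²` has trivial component of degree two, its component of degree three lies in the
ideal generated by the image of `R`. -/
theorem θ₃_mem_tensorIdeal [IsFreeGroup F] {z : MonoidAlgebra ℤ F} (hz : z ∈ relAugIdeal R ^ 2)
    (h : M.θ₂ z = 0) : M.θ₃ z ∈ tensorIdeal (abImage R) := by
  obtain ⟨β, hβ⟩ := M.exists_bilinear_θ₃Class R
  have hinj : Function.Injective (TensorProduct.map (abImage R).subtype (abImage R).subtype) := by
    -- A subgroup of a free abelian group is torsion-free, hence flat over ℤ.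
    have : Module.Flat ℤ (abImage R) := inferInstance
    exact TensorProduct.map_injective_of_flat_flat _ _ (abImage R).injective_subtype
      (abImage R).injective_subtype
  have key : ∃ t : abImage R ⊗[ℤ] abImage R,
      TensorProduct.map (abImage R).subtype (abImage R).subtype t = M.θ₂ z ∧
      lift β t = (tensorIdeal (abImage R)).mkQ (M.θ₃ z) := by
    rw [pow_two, relAugIdeal_eq_span, Submodule.span_mul_span] at hz
    -- The vanishing of θ₂(z) does not pass to summands of z, so the common lift t is built for
    -- every element of 𝔯² and the vanishing is used only afterwards.
    clear h
    induction hz using Submodule.span_induction with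
    | mem z hz =>
      obtain ⟨_, ⟨r, hr, rfl⟩, _, ⟨s, hs, rfl⟩, rfl⟩ := hz
      refine ⟨⟨toAb r, r, hr, rfl⟩ ⊗ₜ ⟨toAb s, s, hs, rfl⟩, ?_, ?_⟩
      · change toAb r ⊗ₜ toAb s = M.θ₂ ((of ℤ F r - 1) * (of ℤ F s - 1))
        rw [M.θ₂_mul (of_sub_one_mem_augIdeal r) (of_sub_one_mem_augIdeal s), θ₁_of_sub_one,
          θ₁_of_sub_one]
      · exact (lift.tmul _ _).trans (hβ r hr s hs)
    | zero => exact ⟨0, by simp, by simp⟩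
    | add x y _ _ hx hy =>
      obtain ⟨t, h₁, h₂⟩ := hx
      obtain ⟨t', h₁', h₂'⟩ := hy
      exact ⟨t + t', by rw [map_add, map_add, h₁, h₁'], by
        rw [map_add, map_add, map_add, h₂, h₂']⟩
    | smul c x _ hx =>
      obtain ⟨t, h₁, h₂⟩ := hx
      exact ⟨c • t, by rw [map_smul, map_smul, h₁], by rw [map_smul, map_smul, map_smul, h₂]⟩
  obtain ⟨t, h₁, h₂⟩ := key
  rw [h] at h₁
  rw [hinj (h₁.trans (map_zero _).symm), map_zero] at h₂
  exact (Submodule.Quotient.mk_eq_zero _).1 h₂.symm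

end MagnusMaps

/-! ### The third and fourth dimension subgroups -/

theorem subset_dimSet_three (R : Subgroup F) [R.Normal] :
    ((γ 2 R ⊔ γ 3 (⊤ : Subgroup F) : Subgroup F) : Set F) ⊆ dimSet 3 (relAugIdeal R ^ 2) := by
  intro w hw
  have : (γ 3 (⊤ : Subgroup F)).Normal :=
    inferInstanceAs ((⊤ : Subgroup F).lowerCentralSeries 2).Normal
  obtain ⟨u, hu, v, hv, rfl⟩ := Subgroup.mem_sup_of_normal_right.1 hw
  have hu' : of ℤ F u - 1 ∈ relAugIdeal R ^ 2 := of_sub_one_mem_relAugIdeal_pow R 1 u hu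
  have hv' : of ℤ F v - 1 ∈ augIdeal F ^ 3 := of_sub_one_mem_augIdeal_pow hv
  change of ℤ F (u * v) - 1 ∈ relAugIdeal R ^ 2 ⊔ augIdeal F ^ 3
  rw [of_mul_sub_one]
  exact add_mem (add_mem (Submodule.mem_sup_right
      (augIdeal_mul_mem (by omega) (by omega) (of_sub_one_mem_pow_one u) hv'))
    (Submodule.mem_sup_left hu')) (Submodule.mem_sup_right hv')

theorem dimSet_three_mul_top_subset (R : Subgroup F) :
    dimSet 3 (relAugIdeal R ^ 2 * ⊤) ⊆ dimSet 3 (relAugIdeal R ^ 2) := by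
  have h : relAugIdeal R ^ 2 * augIdeal F ≤ augIdeal F ^ 3 := by
    rw [pow_succ _ 2]
    exact mul_le_mul_left (pow_le_pow_left' (relAugIdeal_le_augIdeal R) 2) _
  intro w hw
  exact sup_le ((mul_top_le _).trans (sup_le_sup_left h _)) le_sup_right hw

theorem dimSet_three_subset [IsFreeGroup F] (R : Subgroup F) [R.Normal] :
    dimSet 3 (relAugIdeal R ^ 2) ⊆ ((γ 2 R ⊔ γ 3 (⊤ : Subgroup F) : Subgroup F) : Set F) := by
  obtain ⟨M⟩ := nonempty_magnusMaps F
  intro w hw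
  obtain ⟨z, hz, v, hv, hzv⟩ := Submodule.mem_sup.1 hw
  have hz2 : z ∈ augIdeal F ^ 2 := pow_le_pow_left' (relAugIdeal_le_augIdeal R) 2 hz
  have hv2 : v ∈ augIdeal F ^ 2 := augIdeal_pow_antitone (by omega) (by omega) hv
  have hw1 : w ∈ (⊤ : Subgroup F).lowerCentralSeries 1 := by
    rw [← toAb_eq_zero_iff, ← M.θ₁_of_sub_one, ← hzv]
    exact M.θ₁_eq_zero (add_mem hz2 hv2)
  refine mem_of_θ₂_mem_tensorSq M R hw1 ?_
  rw [← hzv, map_add, M.θ₂_eq_zero hv, add_zero]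
  exact M.θ₂_mem_tensorSq hz

/-- The key case of the fourth dimension subgroup: elements of `γ₃(F)`. -/
theorem mem_of_mem_dimSet_four [IsFreeGroup F] (R : Subgroup F) [R.Normal] {w : F}
    (hw3 : w ∈ (⊤ : Subgroup F).lowerCentralSeries 2)
    (hw : w ∈ dimSet 4 (relAugIdeal R ^ 2 * ⊤)) :
    w ∈ R ⊔ (⊤ : Subgroup F).lowerCentralSeries 3 := by
  obtain ⟨M⟩ := nonempty_magnusMaps F
  obtain ⟨x, hx, v, hv, hxv⟩ := Submodule.mem_sup.1 hw
  obtain ⟨z, hz, y, hy, rfl⟩ := Submodule.mem_sup.1 (mul_top_le _ hx)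
  have hy3 : y ∈ augIdeal F ^ 3 := by
    rw [pow_succ _ 2]
    exact mul_le_mul_left (pow_le_pow_left' (relAugIdeal_le_augIdeal R) 2) _ hy
  -- In z = (w - 1) - y - v every term on the right lies in 𝔣³, the first because w ∈ γ₃(F).
  have hθ₂ : M.θ₂ z = 0 := by
    have h := M.θ₂_eq_zero (of_sub_one_mem_augIdeal_pow hw3)
    rwa [← hxv, map_add, map_add, M.θ₂_eq_zero hy3,
      M.θ₂_eq_zero (augIdeal_pow_antitone (by omega) (by omega) hv), add_zero, add_zero] at h
  refine mem_of_θ₃_mem_tensorIdeal M R hw3 ?_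
  rw [← hxv, map_add, map_add, M.θ₃_eq_zero hv, add_zero]
  exact add_mem (M.θ₃_mem_tensorIdeal hz hθ₂) (M.θ₃_mem_tensorIdeal_of_relSq_mul hy)

theorem dimSet_four_subset [IsFreeGroup F] (R : Subgroup F) [R.Normal] :
    dimSet 4 (relAugIdeal R ^ 2 * ⊤) ⊆
      ((R ⊔ γ 4 (⊤ : Subgroup F) : Subgroup F) : Set F) := by
  intro w hw
  have hw3 : w ∈ dimSet 3 (relAugIdeal R ^ 2 * ⊤) :=
    sup_le_sup_left (augIdeal_pow_antitone (by omega) (by omega)) _ hw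
  have : (γ 3 (⊤ : Subgroup F)).Normal :=
    inferInstanceAs ((⊤ : Subgroup F).lowerCentralSeries 2).Normal
  obtain ⟨u, hu, v, hv, rfl⟩ := Subgroup.mem_sup_of_normal_right.1
    (dimSet_three_subset R (dimSet_three_mul_top_subset R hw3))
  have huR : u ∈ R := lowerCentralSeries_le_self R 1 hu
  have hu' : of ℤ F u⁻¹ - 1 ∈ relAugIdeal R ^ 2 :=
    of_sub_one_mem_relAugIdeal_pow R 1 _ (inv_mem hu)
  -- Writing v = u⁻¹(uv) produces the cross term (u⁻¹ - 1)(uv - 1), which is absorbed because 𝔯²ℤ[F]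
  -- is a right ideal.
  have hmul : ∀ x, (of ℤ F u⁻¹ - 1) * x ∈ relAugIdeal R ^ 2 * ⊤ ⊔ augIdeal F ^ 4 := fun x =>
    Submodule.mem_sup_left (Submodule.mul_mem_mul hu' Submodule.mem_top)
  have hv4 : v ∈ dimSet 4 (relAugIdeal R ^ 2 * ⊤) := by
    change of ℤ F v - 1 ∈ relAugIdeal R ^ 2 * ⊤ ⊔ augIdeal F ^ 4
    rw [← inv_mul_cancel_left u v, of_mul_sub_one]
    exact add_mem (add_mem (hmul _) (Submodule.mem_sup_left (le_mul_top _ hu'))) hw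
  exact mul_mem (le_sup_left (α := Subgroup F) huR) (mem_of_mem_dimSet_four R hv hv4)

end GenDimension

end

theorem mainTheorem4 {F : Type*} [Group F] [IsFreeGroup F] (R : Subgroup F) [R.Normal] :
    (GenDimension.dimSet 3 (GenDimension.relAugIdeal R ^ 2) =
        ((GenDimension.γ 2 R ⊔ GenDimension.γ 3 (⊤ : Subgroup F) : Subgroup F) : Set F) ∧
      GenDimension.dimSet 3 (GenDimension.relAugIdeal R ^ 2 * ⊤) =
        ((GenDimension.γ 2 R ⊔ GenDimension.γ 3 (⊤ : Subgroup F) : Subgroup F) : Set F)) ∧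
    GenDimension.dimSet 4 (GenDimension.relAugIdeal R ^ 2 * ⊤) ⊆
      ((R ⊔ GenDimension.γ 4 (⊤ : Subgroup F) : Subgroup F) : Set F) := by
  have h₁ := GenDimension.subset_dimSet_three R
  have h₂ := GenDimension.dimSet_three_subset R
  have h₃ := GenDimension.dimSet_three_mul_top_subset R
  have h₄ : GenDimension.dimSet 3 (GenDimension.relAugIdeal R ^ 2) ⊆
      GenDimension.dimSet 3 (GenDimension.relAugIdeal R ^ 2 * ⊤) := fun w hw =>
    sup_le_sup_right (GenDimension.le_mul_top _) _ hw
  exact ⟨⟨h₂.antisymm h₁, (h₃.trans h₂).antisymm (h₁.trans h₄)⟩,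
    GenDimension.dimSet_four_subset R⟩
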